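/- **Setting.** Let $T\ge 0$, let $(\Omega,\mathcal F,P)$ be a probability space carrying a countable family $(W^i)_{i\in\mathbb I}$ of independent standard real Brownian motions on $[0,T]$, and let $(\mathcal F_t)_{0\le t\le T}$ be the filtration generated by the $W^i$ and completed by the $P$-null sets. Let $\gamma$ be a progressively measurable process with values in $\ell^2(\mathbb I)$ such that $$E\Big[\exp\Big(\alpha\int_0^T\|\gamma_t\|_{\ell^2}^2\,dt\Big)\Big]<\infty\qquad\text{for all }\alpha\ge 0$$ (any market price of risk process of a strongly arbitrage-free market, i.e. such a $\gamma$ which moreover satisfies $m_t=\sigma_t\gamma_t$ for the drift $m$ and the volatility operator $\sigma$ of the market, is of this kind; the relation $m=\sigma\gamma$ itself is not needed), and put $$\xi_T=\exp\Big(-\tfrac12\int_0^T\|\gamma_t\|_{\ell^2}^2\,dt-\sum_{i\in\mathbb I}\int_0^T\gamma^i_t\,dW^i_t\Big).$$ A function $U:\mathbb R\to\{-\infty\}\cup\mathbb R$ is called *admissible* if: 1. $U$ is concave and upper semicontinuous; 2. there is $a\in\{-\infty\}\cup\,]-\infty,0]$ such that $U(x)=-\infty$ for $x<a$ and $U(x)>-\infty$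 for $x>a$; 3. $U$ is twice differentiable on $A=\,]a,\infty[$; set $B=U'(A)$; 4. $\sup B=+\infty$, and $\inf B=0$ or $\inf B=-\infty$; 5. $U':A\to B$ is one-to-one, and there are positive constants $r,c_1,c_2,c_3$ such that its inverse $I=(U')^{-1}:B\to A$ is differentiable at every $y\in B\setminus\{0\}$ and satisfies $|I(y)|+|yI'(y)|\le c_1+c_2|y|^r+c_3|y|^{-r}$ there. **Proposition.** Let $U$ be admissible and let $v\in A$. Then $\xi_T\in L^2(P)$; for every $X\in L^2(P)$ the positive part of $U(X)$ is integrable, so that $E[U(X)]\in[-\infty,\infty[$ is well defined; and there is a unique $\hat\lambda\in B$ with $E[\xi_T\,I(\hat\lambda\xi_T)]=v$. The random variable $\hat X=I(\hat\lambda\xi_T)$ is the unique solution, up to $P$-almost sure equality, of the problem $$\sup\big\{E[U(X)] : X\in L^2(\Omega,\mathcal F_T,P),\ E[\xi_T X]=v\big\},$$ that is, $\hat X$ satisfies these constraints, $E[U(X)]\le E[U(\hat X)]$ for every $X$ satisfying them, and every $X$ satisfying them and attaining the maximum equals $\hat X$ almost surely. Moreover $E[U(\hat X)]$ is finite. -/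

import Mathlib

open MeasureTheory ProbabilityTheory Filter Topology
open scoped NNReal ENNReal

noncomputable section

/-! ### Brownian motions, their filtration, and the Itô integral -/

/-- `X` is a standard real Brownian motion on the time interval `[0, T]`. -/
structure IsBrownianOn {Ω : Type*} [MeasurableSpace Ω] (P : Measure Ω) (T : ℝ≥0)
    (X : ℝ≥0 → Ω → ℝ) : Prop where
  zero : ∀ᵐ ω ∂P, X 0 ω = 0
  law : ∀ s t : ℝ≥0, s ≤ t → t ≤ T →
    HasLaw (fun ω => X t ω - X s ω) (gaussianReal 0 (t - s)) P
  indep : HasIndepIncrements (fun (t : Set.Iic T) (ω : Ω) => X t ω) P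
  cont : ∀ᵐ ω ∂P, ContinuousOn (fun t => X t ω) (Set.Iic T)

/-- `(W i)` is a family of independent standard real Brownian motions on `[0, T]`. -/
structure IsBrownianFamilyOn {Ω ι : Type*} [MeasurableSpace Ω] (P : Measure Ω) (T : ℝ≥0)
    (W : ι → ℝ≥0 → Ω → ℝ) : Prop where
  brownian : ∀ i, IsBrownianOn P T (W i)
  indep : iIndepFun (fun (i : ι) (ω : Ω) (t : Set.Iic T) => W i t ω) P

/-- The filtration generated by the processes `W i` and completed by the null sets:
at time `t` it is generated by all `W i s` with `s ≤ t` and by the sets of measure zero. -/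
def generatedFiltration {Ω ι : Type*} [mΩ : MeasurableSpace Ω] (P : Measure Ω)
    (W : ι → ℝ≥0 → Ω → ℝ) (hW : ∀ i t, Measurable (W i t)) : Filtration ℝ≥0 mΩ where
  seq t := (⨆ i, ⨆ s, ⨆ _ : s ≤ t, MeasurableSpace.comap (W i s) inferInstance) ⊔
    MeasurableSpace.generateFrom {N : Set Ω | MeasurableSet N ∧ P N = 0}
  mono' _ _ hst := sup_le_sup_right
    (iSup_mono fun _ => biSup_mono fun _ h => le_trans h hst) _
  le' _ := sup_le
    (iSup_le fun i => iSup₂_le fun s _ => (hW i s).comap_le)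
    (MeasurableSpace.generateFrom_le fun _ hN => hN.1)

/-- The Hilbert space `ℓ²(ι)` of square summable real families. -/
abbrev Ell2 (ι : Type*) : Type _ := lp (fun _ : ι => ℝ) 2

/-- A simple process on `[0, T]` with values in `ℓ²(ι)`: it takes the value `coeff k` on
`(time k, time (k + 1)]`, `k < num`, and only the coordinates in `support` are nonzero. -/
structure SimpleProcess {Ω : Type*} (ι : Type*) [mΩ : MeasurableSpace Ω] (P : Measure Ω)
    (ℱ : Filtration ℝ≥0 mΩ) (T : ℝ≥0) where
  num : ℕ
  time : ℕ → ℝ≥0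
  mono : Monotone time
  le_horizon : ∀ k, time k ≤ T
  support : Finset ι
  coeff : ℕ → Ω → Ell2 ι
  adapted : ∀ k, StronglyMeasurable[ℱ (time k)] (coeff k)
  memLp : ∀ k, MemLp (coeff k) 2 P
  coeff_eq_zero : ∀ k ω, ∀ i ∉ support, coeff k ω i = 0

namespace SimpleProcess

variable {Ω ι : Type*} [mΩ : MeasurableSpace Ω] {P : Measure Ω} {ℱ : Filtration ℝ≥0 mΩ} {T : ℝ≥0}

/-- The value of a simple process at time `s`. -/
def value (H : SimpleProcess ι P ℱ T) (s : ℝ≥0) (ω : Ω) : Ell2 ι :=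
  ∑ k ∈ Finset.range H.num,
    (Set.Ioc (H.time k) (H.time (k + 1))).indicator (fun _ => H.coeff k ω) s

/-- The integral `∑ i, ∫₀ᵀ Hⁱ dWⁱ` of a simple process. -/
def integral (H : SimpleProcess ι P ℱ T) (W : ι → ℝ≥0 → Ω → ℝ) (ω : Ω) : ℝ :=
  ∑ k ∈ Finset.range H.num, ∑ i ∈ H.support,
    H.coeff k ω i * (W i (H.time (k + 1)) ω - W i (H.time k) ω)

end SimpleProcess

/-- `M` is (a version of) the Itô integral `∑ i, ∫₀ᵀ γⁱ dWⁱ`: for some sequence of simple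
processes `H n` that converges to `γ` in `L²([0, T] × Ω; ℓ²)`, the integrals of the `H n`
converge to `M` in `L²(P)`. -/
def IsItoIntegral {Ω ι : Type*} [mΩ : MeasurableSpace Ω] (P : Measure Ω)
    (ℱ : Filtration ℝ≥0 mΩ) (W : ι → ℝ≥0 → Ω → ℝ) (T : ℝ≥0) (γ : ℝ≥0 → Ω → Ell2 ι)
    (M : Ω → ℝ) : Prop :=
  MemLp M 2 P ∧
  ∃ H : ℕ → SimpleProcess ι P ℱ T,
    Tendsto (fun n => ∫⁻ ω, ∫⁻ s in Set.Icc (0 : ℝ) T,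
      ‖(H n).value s.toNNReal ω - γ s.toNNReal ω‖ₑ ^ 2 ∂volume ∂P) atTop (𝓝 0) ∧
    Tendsto (fun n => eLpNorm (fun ω => (H n).integral W ω - M ω) 2 P) atTop (𝓝 0)

open Classical in
/-- The Itô integral `∑ i, ∫₀ᵀ γⁱ dWⁱ`, a random variable determined up to null sets
(with the value `0` for processes that are not Itô integrable). -/
def itoIntegral {Ω ι : Type*} [mΩ : MeasurableSpace Ω] (P : Measure Ω)
    (ℱ : Filtration ℝ≥0 mΩ) (W : ι → ℝ≥0 → Ω → ℝ) (T : ℝ≥0) (γ : ℝ≥0 → Ω → Ell2 ι) : Ω → ℝ :=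
  if h : ∃ M, IsItoIntegral P ℱ W T γ M then h.choose else 0

/-- The pathwise integral `∫₀ᵀ ‖γ_t‖² dt`. -/
def energy {Ω ι : Type*} (T : ℝ≥0) (γ : ℝ≥0 → Ω → Ell2 ι) (ω : Ω) : ℝ :=
  ∫ s in Set.Icc (0 : ℝ) T, ‖γ s.toNNReal ω‖ ^ 2

/-- The integral `∫₀ᵀ ‖γ_t‖² dt` is a.s. finite and has exponential moments of all orders. -/
def HasExpMoments {Ω ι : Type*} [MeasurableSpace Ω] (P : Measure Ω) (T : ℝ≥0)
    (γ : ℝ≥0 → Ω → Ell2 ι) : Prop :=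
  (∀ᵐ ω ∂P, IntegrableOn (fun s : ℝ => ‖γ s.toNNReal ω‖ ^ 2) (Set.Icc 0 T)) ∧
  ∀ a : ℝ, 0 ≤ a → Integrable (fun ω => Real.exp (a * energy T γ ω)) P

/-- The density `ξ_T = exp(-½ ∫₀ᵀ ‖γ_t‖² dt - ∑ i, ∫₀ᵀ γⁱ dWⁱ)`. -/
def girsanovDensity {Ω ι : Type*} [mΩ : MeasurableSpace Ω] (P : Measure Ω)
    (ℱ : Filtration ℝ≥0 mΩ) (W : ι → ℝ≥0 → Ω → ℝ) (T : ℝ≥0) (γ : ℝ≥0 → Ω → Ell2 ι)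
    (ω : Ω) : ℝ :=
  Real.exp (-(1 / 2) * energy T γ ω - itoIntegral P ℱ W T γ ω)

/-! ### Utility functions -/

/-- The open interval `A = ]a, ∞[`. -/
def utilityInterval (a : EReal) : Set ℝ := {x : ℝ | a < (x : EReal)}

/-- The marginal utility `U'` (only meaningful where `U` is finite). -/
def marginal (U : ℝ → EReal) : ℝ → ℝ := deriv fun x => (U x).toReal

/-- The range `B = U'(A)`. -/
def marginalRange (U : ℝ → EReal) (a : EReal) : Set ℝ := marginal U '' utilityInterval a

/-- The inverse `I : B → A` of `U' : A → B`. -/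
def inverseMarginal (U : ℝ → EReal) (a : EReal) : ℝ → ℝ :=
  Function.invFunOn (marginal U) (utilityInterval a)

/-- Admissible utility functions `U : ℝ → {-∞} ∪ ℝ`, with left end point `a ∈ {-∞} ∪ ]-∞, 0]`.
In `estimate` the point `y = 0` is left out because `|0| ^ (-r)` stands for `+∞`. -/
structure IsAdmissibleUtility (U : ℝ → EReal) (a : EReal) : Prop where
  ne_top : ∀ x, U x ≠ ⊤
  concave : ∀ x y s t : ℝ, 0 < s → 0 < t → s + t = 1 →
    (s : EReal) * U x + (t : EReal) * U y ≤ U (s * x + t * y)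
  usc : UpperSemicontinuous U
  nonpos : a ≤ 0
  eq_bot : ∀ x : ℝ, (x : EReal) < a → U x = ⊥
  ne_bot : ∀ x : ℝ, a < (x : EReal) → U x ≠ ⊥
  differentiable : DifferentiableOn ℝ (fun x => (U x).toReal) (utilityInterval a)
  twice_differentiable : DifferentiableOn ℝ (marginal U) (utilityInterval a)
  sup_range : ¬ BddAbove (marginalRange U a)
  inf_range : IsGLB (marginalRange U a) 0 ∨ ¬ BddBelow (marginalRange U a)
  injOn : Set.InjOn (marginal U) (utilityInterval a)
  estimate : ∃ r c₁ c₂ c₃ : ℝ, 0 < r ∧ 0 < c₁ ∧ 0 < c₂ ∧ 0 < c₃ ∧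
    ∀ y ∈ marginalRange U a, y ≠ 0 →
      DifferentiableAt ℝ (inverseMarginal U a) y ∧
      |inverseMarginal U a y| + |y * deriv (inverseMarginal U a) y| ≤
        c₁ + c₂ * |y| ^ r + c₃ * |y| ^ (-r)

/-! ### The optimisation problem -/

/-- The positive part of `E[f]`, for `f` with values in `[-∞, ∞]`. -/
def posExpectation {Ω : Type*} [MeasurableSpace Ω] (P : Measure Ω) (f : Ω → EReal) : ℝ≥0∞ :=
  ∫⁻ ω, (f ω).toENNReal ∂P

/-- The expectation `E[f] = E[f⁺] - E[f⁻]` in `[-∞, ∞]`, meaningful as soon as one of the two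
parts is finite. -/
def extExpectation {Ω : Type*} [MeasurableSpace Ω] (P : Measure Ω) (f : Ω → EReal) : EReal :=
  (posExpectation P f : EReal) - (posExpectation P (fun ω => -f ω) : EReal)

/-- The constraints `X ∈ L²(Ω, 𝒢, P)` and `E[ξ X] = v`. -/
structure IsFeasible {Ω : Type*} (𝒢 : MeasurableSpace Ω) [mΩ : MeasurableSpace Ω]
    (P : Measure Ω) (ξ : Ω → ℝ) (v : ℝ) (X : Ω → ℝ) : Prop where
  measurable : AEStronglyMeasurable[𝒢] X P
  memLp : MemLp X 2 P
  budget : ∫ ω, ξ ω * X ω ∂P = v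

/-- `X` maximises `E[U(Y)]` among all `Y ∈ L²(Ω, 𝒢, P)` with `E[ξ Y] = v`. -/
structure IsMaximiser {Ω : Type*} (𝒢 : MeasurableSpace Ω) [mΩ : MeasurableSpace Ω]
    (P : Measure Ω) (ξ : Ω → ℝ) (v : ℝ) (U : ℝ → EReal) (X : Ω → ℝ) : Prop where
  feasible : IsFeasible 𝒢 P ξ v X
  optimal : ∀ Y, IsFeasible 𝒢 P ξ v Y →
    extExpectation P (fun ω => U (Y ω)) ≤ extExpectation P (fun ω => U (X ω))

/-- The random variable `X_lam = I(lam ξ)`. -/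
def candidate {Ω : Type*} (U : ℝ → EReal) (a : EReal) (ξ : Ω → ℝ) (lam : ℝ) (ω : Ω) : ℝ :=
  inverseMarginal U a (lam * ξ ω)

/-- `lam ∈ B` and `E[ξ X_lam] = v`. -/
def IsMultiplier {Ω : Type*} [MeasurableSpace Ω] (P : Measure Ω) (U : ℝ → EReal) (a : EReal)
    (ξ : Ω → ℝ) (v lam : ℝ) : Prop :=
  lam ∈ marginalRange U a ∧ ∫ ω, ξ ω * candidate U a ξ lam ω ∂P = v

end

/-!
# Optimal terminal wealth for a state price density driven by countably many Brownian motions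

The proof has a probabilistic and a convex analytic half, which meet in `IsStatePriceDensity`:
`ξ` is positive, measurable with respect to the terminal `σ`-algebra, has moments of all orders,
positive and negative, and has mean one.

**The density.** An increment of a Brownian motion of the family after time `s` is independent of
`ℱ s` (`IsBrownianFamilyOn.indep_generatedFiltration`). For simple processes `H` this yields the Itô
isometry (`SimpleProcess.lintegral_integral_sub`) and, by induction on the number of steps, the
identity `E[exp (q ∫ H dW - q² / 2 ∫ ‖H‖² dt)] = 1` (`SimpleProcess.lintegral_exp`). A progressive
process `γ` is approximated by `gridProcess`: on each interval of a grid it takes the average of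
finitely many coordinates of `γ` over the *preceding* interval, so that it is adapted, its energy
is at most that of `γ` on every path, and it converges to `γ` by Lebesgue's differentiation theorem.
The isometry then makes the stochastic integrals converge, so the Itô integral exists. As all
energies lie below that of `γ`, the exponential moments of the latter bound the moments of the
approximating densities uniformly, hence those of `ξ`; boundedness in `L²` prevents loss of mass in
the limit, so `E[ξ] = 1` (`ExponentialApproximation`).

**The optimisation problem.** For `λ ∈ B` put `X_λ = I(λξ)`, so that `U'(X_λ) = λξ`. The growth
condition on `I` and the moments of `ξ` give `X_λ ∈ L²`. The budget `E[ξ X_λ]` is strictly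
decreasing and continuous in `λ`; truncating `I` at a level `b` and using `E[ξ] = 1` shows that it
takes values on both sides of `v ∈ A`, whence the unique multiplier
(`IsAdmissibleUtility.existsUnique_isMultiplier`). The concave function `U` lies below its tangent
at `X_λ`, that is, `U(X) ≤ U(X_λ) + λξ (X - X_λ)`, strictly where `X ≠ X_λ`
(`IsAdmissibleUtility.lt_tangent`). If `E[ξ X] = E[ξ X_λ]`, the right-hand side has expectation
`E[U(X_λ)]`, which gives optimality, and equality in expectation forces `X = X_λ` almost surely.
-/

noncomputable section

/-! ### Brownian families as Gaussian processes -/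

section Brownian

variable {Ω ι : Type*} [mΩ : MeasurableSpace Ω] {P : Measure Ω} {T : ℝ≥0}

theorem IsBrownianOn.hasLaw {X : ℝ≥0 → Ω → ℝ} (hX : IsBrownianOn P T X) {t : ℝ≥0} (ht : t ≤ T) :
    HasLaw (X t) (gaussianReal 0 t) P := by
  have h := hX.law 0 t zero_le ht
  rw [tsub_zero] at h
  refine h.congr ?_
  filter_upwards [hX.zero] with ω hω
  simp [hω]

theorem IsBrownianOn.isGaussianProcess {X : ℝ≥0 → Ω → ℝ} (hX : IsBrownianOn P T X) :
    IsGaussianProcess (fun (t : Set.Iic T) ω => X t ω) P :=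
  hX.indep.isGaussianProcess (fun t => (hX.hasLaw t.2).hasGaussianLaw) hX.zero

theorem IsBrownianOn.covariance_of_le [IsProbabilityMeasure P] {X : ℝ≥0 → Ω → ℝ}
    (hX : IsBrownianOn P T X) {s t : ℝ≥0}
    (hst : s ≤ t) (ht : t ≤ T) : cov[X s, X t; P] = s := by
  have h1 := hX.indep.indepFun_eval_sub (r := ⟨0, Set.mem_Iic.2 zero_le⟩) (s := ⟨s, hst.trans ht⟩)
    (t := ⟨t, ht⟩) (zero_le : (0 : ℝ≥0) ≤ s) hst hX.zero
  have ls := hX.hasLaw (hst.trans ht)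
  have lt := hX.hasLaw ht
  change X s ⟂ᵢ[P] (X t - X s) at h1
  have h2 : X t = X t - X s + X s := by simp
  have m1 := ls.hasGaussianLaw.memLp_two
  have m2 := lt.hasGaussianLaw.memLp_two
  rw [h2, covariance_add_right m1 (m2.sub m1) m1, h1.covariance_eq_zero m1 (m2.sub m1),
    covariance_self ls.aemeasurable, ls.variance_eq, variance_id_gaussianReal]
  simp

variable {W : ι → ℝ≥0 → Ω → ℝ}

theorem IsBrownianFamilyOn.isGaussianProcess (hW : IsBrownianFamilyOn P T W) :
    IsGaussianProcess (fun (p : ι × Set.Iic T) ω => W p.1 p.2 ω) P where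
  hasGaussianLaw I := by
    classical
    let S : Finset ι := I.image Prod.fst
    let J : Finset (Set.Iic T) := I.image Prod.snd
    have h1 : HasGaussianLaw (fun ω (i : S) => J.restrict (fun t : Set.Iic T => W i t ω)) P := by
      have hB := fun i : ι => IsBrownianOn.isGaussianProcess (hW.brownian i)
      refine iIndepFun.hasGaussianLaw (fun i => (hB i).hasGaussianLaw J) ?_
      exact (hW.indep.precomp (g := ((↑) : S → ι)) Subtype.val_injective).comp
        (fun _ x => J.restrict x) (fun _ => by fun_prop)
    let L : (S → J → ℝ) →L[ℝ] (I → ℝ) :=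
      { toFun x p := x ⟨p.1.1, Finset.mem_image_of_mem _ p.2⟩ ⟨p.1.2, Finset.mem_image_of_mem _ p.2⟩
        map_add' := by intros; rfl
        map_smul' := by intros; rfl
        cont := by fun_prop }
    exact h1.map L

theorem IsBrownianFamilyOn.covariance [IsProbabilityMeasure P] [DecidableEq ι]
    (hW : IsBrownianFamilyOn P T W) (i j : ι) {s t : ℝ≥0} (hs : s ≤ T) (ht : t ≤ T) :
    cov[W i s, W j t; P] = if i = j then ((min s t : ℝ≥0) : ℝ) else 0 := by
  split_ifs with h
  · subst h
    rcases le_total s t with hst | hst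
    · rw [(hW.brownian i).covariance_of_le hst ht, min_eq_left hst]
    · rw [covariance_comm, (hW.brownian i).covariance_of_le hst hs, min_eq_right hst]
  · have := (hW.indep.indepFun h).comp (measurable_pi_apply (⟨s, hs⟩ : Set.Iic T))
      (measurable_pi_apply (⟨t, ht⟩ : Set.Iic T))
    exact this.covariance_eq_zero ((hW.brownian i).hasLaw hs).hasGaussianLaw.memLp_two
      ((hW.brownian j).hasLaw ht).hasGaussianLaw.memLp_two

/-- The increments after time `s` are independent of the past, before completion. -/
theorem IsBrownianFamilyOn.indepFun_past [IsProbabilityMeasure P] (hW : IsBrownianFamilyOn P T W)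
    {s : ℝ≥0} (hs : s ≤ T) :
    IndepFun (fun ω (p : ι × Set.Iic s) => W p.1 p.2 ω)
      (fun ω (p : ι × Set.Icc s T) => W p.1 p.2 ω - W p.1 s ω) P := by
  classical
  have hG := hW.isGaussianProcess
  have hL : ∀ i {t : ℝ≥0} (ht : t ≤ T), MemLp (W i t) 2 P := fun i t ht =>
    ((hW.brownian i).hasLaw ht).hasGaussianLaw.memLp_two
  refine IsGaussianProcess.indepFun_of_covariance_eq_zero
    (X := fun (p : ι × Set.Iic s) ω => W p.1 p.2 ω)
    (Y := fun (p : ι × Set.Icc s T) ω => W p.1 p.2 ω - W p.1 s ω) ?_ ?_ ?_ ?_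
  · refine hG.of_isGaussianProcess ?_
    rintro (⟨i, u⟩ | ⟨i, t⟩)
    · exact ⟨{(i, ⟨u.1, u.2.trans hs⟩)}, ContinuousLinearMap.proj ⟨_, Finset.mem_singleton_self _⟩,
        fun ω => rfl⟩
    · exact ⟨{(i, ⟨t.1, t.2.2⟩), (i, ⟨s, hs⟩)},
        ContinuousLinearMap.proj ⟨(i, ⟨t.1, t.2.2⟩), by simp⟩ -
          ContinuousLinearMap.proj ⟨(i, ⟨s, hs⟩), by simp⟩, fun ω => rfl⟩
  · exact fun p => (hL _ (p.2.2.trans hs)).aestronglyMeasurable.aemeasurable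
  · exact fun p => ((hL _ p.2.2.2).sub (hL _ hs)).aestronglyMeasurable.aemeasurable
  · rintro ⟨i, u, hu⟩ ⟨j, t, ht⟩
    have hu' : u ≤ s := hu
    have := covariance_sub_right (hL i (hu'.trans hs)) (hL j ht.2) (hL j hs)
    change cov[W i u, W j t - W j s; P] = 0
    rw [this, hW.covariance i j (hu'.trans hs) ht.2, hW.covariance i j (hu'.trans hs) hs,
      min_eq_left hu', min_eq_left (hu'.trans ht.1)]
    simp

variable {hWm : ∀ i t, Measurable (W i t)}

theorem generatedFiltration_le_eventuallyMeasurableSpace (s : ℝ≥0) :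
    generatedFiltration P W hWm s ≤ eventuallyMeasurableSpace
      (MeasurableSpace.comap (fun ω (p : ι × Set.Iic s) => W p.1 p.2 ω) inferInstance) (ae P) := by
  refine sup_le ?_ ?_
  · refine (iSup_le fun i => iSup₂_le fun u hu => ?_).trans le_eventuallyMeasurableSpace
    have : W i u = (fun x : ι × Set.Iic s → ℝ => x (i, ⟨u, hu⟩)) ∘
        (fun ω (p : ι × Set.Iic s) => W p.1 p.2 ω) := rfl
    rw [this, ← MeasurableSpace.comap_comp]
    exact MeasurableSpace.comap_mono (measurable_pi_apply _).comap_le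
  · refine MeasurableSpace.generateFrom_le fun N hN => ?_
    exact ⟨∅, @MeasurableSet.empty _ (_), ae_eq_empty.2 hN.2⟩

/-- The increments after time `s` are independent of the completed `σ`-algebra at time `s`. -/
theorem IsBrownianFamilyOn.indep_generatedFiltration [IsProbabilityMeasure P]
    (hW : IsBrownianFamilyOn P T W) {s : ℝ≥0} (hs : s ≤ T) :
    Indep (generatedFiltration P W hWm s)
      (MeasurableSpace.comap (fun ω (p : ι × Set.Icc s T) => W p.1 p.2 ω - W p.1 s ω)
        inferInstance) P := by
  rw [Indep_iff]
  intro A C hA hC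
  obtain ⟨B, hB, hAB⟩ := generatedFiltration_le_eventuallyMeasurableSpace s A hA
  have h := (Indep_iff _ _ _).1 ((IndepFun_iff_Indep _ _ _).1 (hW.indepFun_past hs)) B C hB hC
  rw [measure_congr hAB, ← h]
  exact measure_congr (hAB.inter (ae_eq_refl C))

theorem generatedFiltration_measurable (i : ι) {s t : ℝ≥0} (hst : s ≤ t) :
    Measurable[generatedFiltration P W hWm t] (W i s) := by
  refine measurable_iff_comap_le.2 (le_trans ?_ le_sup_left)
  exact le_iSup_of_le i (le_iSup₂_of_le s hst le_rfl)

end Brownian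

/-! ### Covariances of elementary stochastic integrals -/

section Covariance

variable {Ω ι : Type*} {W : ι → ℝ≥0 → Ω → ℝ}

/-- The increment `W i t - W i s`. -/
def brownianIncrement (W : ι → ℝ≥0 → Ω → ℝ) (i : ι) (s t : ℝ≥0) (ω : Ω) : ℝ := W i t ω - W i s ω

theorem brownianIncrement_add (i : ι) (r s t : ℝ≥0) (ω : Ω) :
    brownianIncrement W i r t ω = brownianIncrement W i r s ω + brownianIncrement W i s t ω := by
  simp [brownianIncrement]

variable [mΩ : MeasurableSpace Ω] {P : Measure Ω} {T : ℝ≥0}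
  {hWm : ∀ i t, Measurable (W i t)}

theorem measurable_brownianIncrement (hWm : ∀ i t, Measurable (W i t)) (i : ι) (s t : ℝ≥0) :
    Measurable (brownianIncrement W i s t) := (hWm i t).sub (hWm i s)

theorem generatedFiltration_measurable_increment (i : ι) {s t u : ℝ≥0} (hs : s ≤ u) (ht : t ≤ u) :
    Measurable[generatedFiltration P W hWm u] (brownianIncrement W i s t) :=
  (generatedFiltration_measurable i ht).sub (generatedFiltration_measurable i hs)

theorem IsBrownianFamilyOn.memLp_increment (hW : IsBrownianFamilyOn P T W) (i : ι) {s t : ℝ≥0}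
    (hst : s ≤ t) (ht : t ≤ T) : MemLp (brownianIncrement W i s t) 2 P :=
  ((hW.brownian i).law s t hst ht).hasGaussianLaw.memLp_two

theorem IsBrownianFamilyOn.integral_increment (hW : IsBrownianFamilyOn P T W) (i : ι) {s t : ℝ≥0}
    (hst : s ≤ t) (ht : t ≤ T) : ∫ ω, brownianIncrement W i s t ω ∂P = 0 := by
  have := ((hW.brownian i).law s t hst ht).integral_eq
  rw [integral_id_gaussianReal] at this
  exact this

variable [IsProbabilityMeasure P]

/-- Functions of increments after time `s` are independent of random variables known at time `s`. -/
theorem IsBrownianFamilyOn.indepFun_increment (hW : IsBrownianFamilyOn P T W) {s : ℝ≥0}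
    (hs : s ≤ T) {β δ : Type*} [MeasurableSpace β] [MeasurableSpace δ] {Z : Ω → β}
    (hZ : Measurable[generatedFiltration P W hWm s] Z)
    {φ : (ι × Set.Icc s T → ℝ) → δ} (hφ : Measurable φ) :
    IndepFun Z (fun ω => φ fun p => brownianIncrement W p.1 s p.2 ω) P := by
  rw [IndepFun_iff_Indep]
  refine indep_of_indep_of_le_left
    (indep_of_indep_of_le_right (hW.indep_generatedFiltration (hWm := hWm) hs) ?_) hZ.comap_le
  have : (fun ω => φ fun p : ι × Set.Icc s T => brownianIncrement W p.1 s p.2 ω) =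
    φ ∘ (fun ω (p : ι × Set.Icc s T) => W p.1 p.2 ω - W p.1 s ω) := rfl
  rw [this, ← MeasurableSpace.comap_comp]
  exact MeasurableSpace.comap_mono hφ.comap_le

theorem IsBrownianFamilyOn.indepFun_one_increment (hW : IsBrownianFamilyOn P T W) {s t : ℝ≥0}
    (hst : s ≤ t) (ht : t ≤ T) {Z : Ω → ℝ} (i : ι)
    (hZ : Measurable[generatedFiltration P W hWm s] Z) :
    IndepFun Z (brownianIncrement W i s t) P :=
  hW.indepFun_increment (hst.trans ht) hZ (measurable_pi_apply (i, (⟨t, hst, ht⟩ : Set.Icc s T)))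

theorem IsBrownianFamilyOn.integrable_mul_increment (hW : IsBrownianFamilyOn P T W) {s t : ℝ≥0}
    (hst : s ≤ t) (ht : t ≤ T) {Z : Ω → ℝ} (i : ι)
    (hZ : Measurable[generatedFiltration P W hWm s] Z) (hZi : Integrable Z P) :
    Integrable (fun ω => Z ω * brownianIncrement W i s t ω) P :=
  (hW.indepFun_one_increment hst ht i hZ).integrable_mul hZi
    ((hW.memLp_increment i hst ht).integrable one_le_two)

theorem IsBrownianFamilyOn.integral_mul_increment (hW : IsBrownianFamilyOn P T W) {s t : ℝ≥0}
    (hst : s ≤ t) (ht : t ≤ T) {Z : Ω → ℝ} (i : ι)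
    (hZ : Measurable[generatedFiltration P W hWm s] Z) (hZi : Integrable Z P) :
    ∫ ω, Z ω * brownianIncrement W i s t ω ∂P = 0 := by
  rw [(hW.indepFun_one_increment hst ht i hZ).integral_fun_mul_eq_mul_integral hZi.1
    (measurable_brownianIncrement hWm i s t).aestronglyMeasurable, hW.integral_increment i hst ht,
    mul_zero]

theorem IsBrownianFamilyOn.memLp_mul_increment (hW : IsBrownianFamilyOn P T W) {s t : ℝ≥0}
    (hst : s ≤ t) (ht : t ≤ T) {h : Ω → ℝ} (i : ι)
    (hh : Measurable[generatedFiltration P W hWm s] h) (h2 : MemLp h 2 P) :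
    MemLp (fun ω => h ω * brownianIncrement W i s t ω) 2 P := by
  have hi := (hW.indepFun_one_increment hst ht i hh).comp (φ := fun x => x ^ 2)
    (ψ := fun x => x ^ 2) (by fun_prop) (by fun_prop)
  have := hi.integrable_mul h2.integrable_sq (hW.memLp_increment i hst ht).integrable_sq
  refine (memLp_two_iff_integrable_sq ?_).2 ?_
  · exact h2.1.mul (hW.memLp_increment i hst ht).1
  · refine this.congr (ae_of_all _ fun ω => ?_)
    simp [mul_pow]

theorem IsBrownianFamilyOn.integral_increment_mul_increment [DecidableEq ι]
    (hW : IsBrownianFamilyOn P T W) (i j : ι) {s t t' : ℝ≥0} (hst : s ≤ t) (ht : t ≤ T)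
    (hst' : s ≤ t') (ht' : t' ≤ T) :
    ∫ ω, brownianIncrement W i s t ω * brownianIncrement W j s t' ω ∂P =
      if i = j then (min (t : ℝ) t' - s) else 0 := by
  have hm : ∀ i {t : ℝ≥0}, t ≤ T → MemLp (W i t) 2 P := fun i t ht =>
    ((hW.brownian i).hasLaw ht).hasGaussianLaw.memLp_two
  have hs := hst.trans ht
  have h := covariance_eq_sub (hW.memLp_increment i hst ht) (hW.memLp_increment j hst' ht')
  rw [hW.integral_increment i hst ht, zero_mul, sub_zero] at h
  have h1 : ∫ ω, brownianIncrement W i s t ω * brownianIncrement W j s t' ω ∂P =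
    cov[W i t - W i s, W j t' - W j s; P] := h.symm
  rw [h1, covariance_sub_left (hm i ht) (hm i hs) ((hm j ht').sub (hm j hs)),
    covariance_sub_right (hm i ht) (hm j ht') (hm j hs),
    covariance_sub_right (hm i hs) (hm j ht') (hm j hs), hW.covariance i j ht ht',
    hW.covariance i j ht hs, hW.covariance i j hs ht', hW.covariance i j hs hs]
  split_ifs
  · simp [hst, hst']
  · simp

/-- The product of two increments starting at time `s`, tested against a random variable known at
time `s`. -/
theorem IsBrownianFamilyOn.integral_mul_increment_mul_increment [DecidableEq ι]
    (hW : IsBrownianFamilyOn P T W) (i j : ι) {s t t' : ℝ≥0} (hst : s ≤ t) (ht : t ≤ T)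
    (hst' : s ≤ t') (ht' : t' ≤ T) {Z : Ω → ℝ}
    (hZ : Measurable[generatedFiltration P W hWm s] Z) (hZi : Integrable Z P) :
    Integrable (fun ω => Z ω * (brownianIncrement W i s t ω * brownianIncrement W j s t' ω)) P ∧
    ∫ ω, Z ω * (brownianIncrement W i s t ω * brownianIncrement W j s t' ω) ∂P =
      (if i = j then (min (t : ℝ) t' - s) else 0) * ∫ ω, Z ω ∂P := by
  have hi : IndepFun Z (fun ω => brownianIncrement W i s t ω * brownianIncrement W j s t' ω) P :=
    hW.indepFun_increment (hst.trans ht) hZ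
      (φ := fun x => x (i, (⟨t, hst, ht⟩ : Set.Icc s T)) * x (j, (⟨t', hst', ht'⟩ : Set.Icc s T)))
      (by fun_prop)
  have hint := (hW.memLp_increment i hst ht).integrable_mul (hW.memLp_increment j hst' ht')
  refine ⟨hi.integrable_mul hZi hint, ?_⟩
  rw [hi.integral_fun_mul_eq_mul_integral hZi.1 hint.1,
    hW.integral_increment_mul_increment i j hst ht hst' ht', mul_comm]

/-- The length of the intersection of the intervals `(s, t]` and `(s', t']`. -/
def overlap (s t s' t' : ℝ≥0) : ℝ := max 0 (min (t : ℝ) t' - max (s : ℝ) s')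

theorem overlap_comm (s t s' t' : ℝ≥0) : overlap s t s' t' = overlap s' t' s t := by
  rw [overlap, overlap, min_comm, max_comm (s : ℝ)]

theorem IsBrownianFamilyOn.integral_elementary_mul_of_le [DecidableEq ι]
    (hW : IsBrownianFamilyOn P T W) (i j : ι) {s t s' t' : ℝ≥0} (hst : s ≤ t) (ht : t ≤ T)
    (hst' : s' ≤ t') (ht' : t' ≤ T) {h h' : Ω → ℝ}
    (hm : Measurable[generatedFiltration P W hWm s] h) (h2 : MemLp h 2 P)
    (hm' : Measurable[generatedFiltration P W hWm s'] h') (h2' : MemLp h' 2 P) (hss : s ≤ s') :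
    ∫ ω, (h ω * brownianIncrement W i s t ω) * (h' ω * brownianIncrement W j s' t' ω) ∂P =
      (if i = j then overlap s t s' t' else 0) * ∫ ω, h ω * h' ω ∂P := by
  have hmono : Measurable[generatedFiltration P W hWm s'] h :=
    hm.mono ((generatedFiltration P W hWm).mono hss) le_rfl
  rcases le_total t s' with hts | hts
  -- disjoint intervals: the later increment is centred and independent of all other factors
  · have hZ : Measurable[generatedFiltration P W hWm s']
        (fun ω => (h ω * brownianIncrement W i s t ω) * h' ω) :=
      (hmono.mul (generatedFiltration_measurable_increment i hss hts)).mul hm'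
    have hZi : Integrable (fun ω => (h ω * brownianIncrement W i s t ω) * h' ω) P :=
      (hW.memLp_mul_increment hst ht i hm h2).integrable_mul h2'
    have := hW.integral_mul_increment hst' ht' j hZ hZi
    have ho : overlap s t s' t' = 0 := by
      have hts' : (t : ℝ) ≤ s' := hts
      refine max_eq_left ?_
      linarith [min_le_left (t : ℝ) t', le_max_right (s : ℝ) s']
    simp only [ho, ite_self, zero_mul]
    rw [← this]
    exact integral_congr_ae (ae_of_all _ fun ω => by ring)
  -- overlapping intervals: split the earlier increment at `s'`
  · have hZ : Measurable[generatedFiltration P W hWm s']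
        (fun ω => (h ω * brownianIncrement W i s s' ω) * h' ω) :=
      (hmono.mul (generatedFiltration_measurable_increment i hss le_rfl)).mul hm'
    have hZi : Integrable (fun ω => (h ω * brownianIncrement W i s s' ω) * h' ω) P :=
      (hW.memLp_mul_increment hss (hst'.trans ht') i hm h2).integrable_mul h2'
    have e1 := hW.integral_mul_increment hst' ht' j hZ hZi
    have i1 := hW.integrable_mul_increment hst' ht' j hZ hZi
    obtain ⟨i2, e2⟩ := hW.integral_mul_increment_mul_increment (hWm := hWm) i j hts ht hst' ht'
      (Z := fun ω => h ω * h' ω) (hmono.mul hm') (h2.integrable_mul h2')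
    have ho : overlap s t s' t' = min (t : ℝ) t' - s' := by
      have a1 : (s : ℝ) ≤ s' := hss
      have a2 : (s' : ℝ) ≤ t := hts
      have a3 : (s' : ℝ) ≤ t' := hst'
      rw [overlap, max_eq_right a1, max_eq_right]
      exact sub_nonneg.2 (le_min a2 a3)
    rw [ho, ← e2]
    refine Eq.trans ?_ ((integral_add i1 i2).trans (by rw [e1, zero_add]))
    refine integral_congr_ae (ae_of_all _ fun ω => ?_)
    simp only [brownianIncrement_add i s s' t ω]
    ring

/-- The covariance of two elementary stochastic integrals. -/
theorem IsBrownianFamilyOn.integral_elementary_mul [DecidableEq ι]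
    (hW : IsBrownianFamilyOn P T W) (i j : ι) {s t s' t' : ℝ≥0} (hst : s ≤ t) (ht : t ≤ T)
    (hst' : s' ≤ t') (ht' : t' ≤ T) {h h' : Ω → ℝ}
    (hm : Measurable[generatedFiltration P W hWm s] h) (h2 : MemLp h 2 P)
    (hm' : Measurable[generatedFiltration P W hWm s'] h') (h2' : MemLp h' 2 P) :
    ∫ ω, (h ω * brownianIncrement W i s t ω) * (h' ω * brownianIncrement W j s' t' ω) ∂P =
      (if i = j then overlap s t s' t' else 0) * ∫ ω, h ω * h' ω ∂P := by
  rcases le_total s s' with hss | hss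
  · exact hW.integral_elementary_mul_of_le i j hst ht hst' ht' hm h2 hm' h2' hss
  · have := hW.integral_elementary_mul_of_le j i hst' ht' hst ht hm' h2' hm h2 hss
    rw [overlap_comm s', if_congr (eq_comm (a := j)) rfl rfl] at this
    simp only [mul_comm (h _)] at this ⊢
    rw [← this]
    exact integral_congr_ae (ae_of_all _ fun ω => by ring)

end Covariance

/-! ### The Itô isometry for simple processes -/

section Ell2

variable {ι : Type*}

theorem Ell2.continuous_apply (i : ι) : Continuous fun x : Ell2 ι => x i := by
  classical
  have : (fun x : Ell2 ι => x i) = fun x => inner ℝ (lp.single 2 i (1 : ℝ)) x := by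
    ext x
    simp [lp.inner_single_left]
  rw [this]
  fun_prop

theorem Ell2.inner_eq_sum_sum [DecidableEq ι] {S S' : Finset ι} {x y : Ell2 ι}
    (hx : ∀ i ∉ S, x i = 0) (hy : ∀ i ∉ S', y i = 0) :
    inner ℝ x y = ∑ i ∈ S, ∑ j ∈ S', if i = j then x i * y j else 0 := by
  rw [lp.inner_eq_tsum, tsum_eq_sum (s := S) fun i hi => by simp [hx i hi]]
  refine Finset.sum_congr rfl fun i _ => ?_
  rw [Finset.sum_ite_eq]
  split_ifs with h
  · simp [mul_comm]
  · simp [hy i h]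

theorem Ell2.norm_sq_eq_sum {S : Finset ι} {x : Ell2 ι} (hx : ∀ i ∉ S, x i = 0) :
    ‖x‖ ^ 2 = ∑ i ∈ S, x i ^ 2 := by
  rw [← real_inner_self_eq_norm_sq, lp.inner_eq_tsum,
    tsum_eq_sum (s := S) fun i hi => by simp [hx i hi]]
  exact Finset.sum_congr rfl fun i _ => by simp

theorem Ell2.norm_apply_le (x : Ell2 ι) (i : ι) : ‖x i‖ ≤ ‖x‖ :=
  lp.norm_apply_le_norm (by norm_num) x i

end Ell2

theorem Real.toNNReal_mem_Ioc_iff {s : ℝ} {a b : ℝ≥0} :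
    s.toNNReal ∈ Set.Ioc a b ↔ s ∈ Set.Ioc (a : ℝ) b := by
  rw [Set.mem_Ioc, Set.mem_Ioc, Real.lt_toNNReal_iff_coe_lt, Real.toNNReal_le_iff_le_coe]

section Quadratic

variable {α : Type*} [MeasurableSpace α] {μ : Measure α} {f g h : α → ℝ}

theorem integrable_sub_two_mul_add (hf : Integrable f μ) (hg : Integrable g μ)
    (hh : Integrable h μ) : Integrable (fun x => f x - 2 * g x + h x) μ :=
  (hf.sub (hg.const_mul 2)).add hh

theorem integral_sub_two_mul_add (hf : Integrable f μ) (hg : Integrable g μ)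
    (hh : Integrable h μ) :
    ∫ x, (f x - 2 * g x + h x) ∂μ = ∫ x, f x ∂μ - 2 * ∫ x, g x ∂μ + ∫ x, h x ∂μ := by
  rw [← integral_const_mul, ← integral_sub hf (hg.const_mul 2)]
  exact integral_add (hf.sub (hg.const_mul 2)) hh

end Quadratic

namespace SimpleProcess

variable {Ω ι : Type*} [mΩ : MeasurableSpace Ω] {P : Measure Ω} {T : ℝ≥0}

section General

variable {ℱ : Filtration ℝ≥0 mΩ}

theorem coord_measurable (H : SimpleProcess ι P ℱ T) (k : ℕ) (i : ι) :
    Measurable[ℱ (H.time k)] (fun ω => H.coeff k ω i) :=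
  ((Ell2.continuous_apply i).comp_stronglyMeasurable (H.adapted k)).measurable

theorem coord_memLp (H : SimpleProcess ι P ℱ T) (k : ℕ) (i : ι) :
    MemLp (fun ω => H.coeff k ω i) 2 P :=
  (H.memLp k).mono ((Ell2.continuous_apply i).comp_aestronglyMeasurable (H.memLp k).1)
    (ae_of_all _ fun _ => Ell2.norm_apply_le _ i)

theorem value_toNNReal (H : SimpleProcess ι P ℱ T) (s : ℝ) (ω : Ω) :
    H.value s.toNNReal ω = ∑ k ∈ Finset.range H.num,
      (Set.Ioc (H.time k : ℝ) (H.time (k + 1))).indicator (fun _ => H.coeff k ω) s := by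
  refine Finset.sum_congr rfl fun k _ => ?_
  simp only [Set.indicator, Real.toNNReal_mem_Ioc_iff]

theorem value_measurable (H : SimpleProcess ι P ℱ T) (ω : Ω) :
    StronglyMeasurable fun s : ℝ => H.value s.toNNReal ω := by
  simp only [value_toNNReal]
  exact Finset.stronglyMeasurable_fun_sum _ fun k _ =>
    stronglyMeasurable_const.indicator measurableSet_Ioc

theorem value_measurable_uncurry (H : SimpleProcess ι P ℱ T) :
    StronglyMeasurable fun p : Ω × ℝ => H.value p.2.toNNReal p.1 := by
  simp only [value_toNNReal]
  refine Finset.stronglyMeasurable_fun_sum _ fun k _ => ?_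
  have h1 : StronglyMeasurable fun p : Ω × ℝ => H.coeff k p.1 :=
    ((H.adapted k).mono (ℱ.le _)).comp_measurable measurable_fst
  have h2 : MeasurableSet {p : Ω × ℝ | p.2 ∈ Set.Ioc (H.time k : ℝ) (H.time (k + 1))} :=
    measurable_snd measurableSet_Ioc
  exact h1.indicator h2

/-- The pathwise integral `∫₀ᵀ ⟪H, H'⟫ dt`. -/
def bracket (H H' : SimpleProcess ι P ℱ T) (ω : Ω) : ℝ :=
  ∑ k ∈ Finset.range H.num, ∑ l ∈ Finset.range H'.num,
    overlap (H.time k) (H.time (k + 1)) (H'.time l) (H'.time (l + 1)) *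
      inner ℝ (H.coeff k ω) (H'.coeff l ω)

theorem inner_value (H H' : SimpleProcess ι P ℱ T) (s : ℝ) (ω : Ω) :
    inner ℝ (H.value s.toNNReal ω) (H'.value s.toNNReal ω) =
      ∑ k ∈ Finset.range H.num, ∑ l ∈ Finset.range H'.num,
        (Set.Ioc (H.time k : ℝ) (H.time (k + 1)) ∩
          Set.Ioc (H'.time l : ℝ) (H'.time (l + 1))).indicator
            (fun _ => (inner ℝ (H.coeff k ω) (H'.coeff l ω) : ℝ)) s := by
  rw [value_toNNReal, value_toNNReal, sum_inner]
  refine Finset.sum_congr rfl fun k _ => ?_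
  rw [inner_sum]
  refine Finset.sum_congr rfl fun l _ => ?_
  by_cases h1 : s ∈ Set.Ioc (H.time k : ℝ) (H.time (k + 1)) <;>
  by_cases h2 : s ∈ Set.Ioc (H'.time l : ℝ) (H'.time (l + 1)) <;>
  simp only [Set.indicator, Set.mem_inter_iff, h1, h2, if_true, if_false, and_true, and_false,
    inner_zero_left, inner_zero_right]

theorem integrable_inner_value (H H' : SimpleProcess ι P ℱ T) (ω : Ω) :
    IntegrableOn (fun s : ℝ => (inner ℝ (H.value s.toNNReal ω) (H'.value s.toNNReal ω) : ℝ))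
      (Set.Icc (0 : ℝ) T) := by
  simp only [inner_value]
  refine integrable_finsetSum _ fun k _ => integrable_finsetSum _ fun l _ => ?_
  exact (integrable_const _).indicator (measurableSet_Ioc.inter measurableSet_Ioc)

theorem integral_inner_value (H H' : SimpleProcess ι P ℱ T) (ω : Ω) :
    ∫ s in Set.Icc (0 : ℝ) T, (inner ℝ (H.value s.toNNReal ω) (H'.value s.toNNReal ω) : ℝ) =
      H.bracket H' ω := by
  have hm : ∀ k l, MeasurableSet (Set.Ioc (H.time k : ℝ) (H.time (k + 1)) ∩
      Set.Ioc (H'.time l : ℝ) (H'.time (l + 1))) := fun k l =>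
    measurableSet_Ioc.inter measurableSet_Ioc
  simp only [inner_value]
  rw [integral_finsetSum _ fun k _ => integrable_finsetSum _ fun l _ =>
    (integrable_const _).indicator (hm k l)]
  refine Finset.sum_congr rfl fun k _ => ?_
  rw [integral_finsetSum _ fun l _ => (integrable_const _).indicator (hm k l)]
  refine Finset.sum_congr rfl fun l _ => ?_
  rw [integral_indicator (hm k l), Measure.restrict_restrict (hm k l), setIntegral_const,
    smul_eq_mul]
  congr 1
  rw [Set.inter_eq_left.2, Set.Ioc_inter_Ioc, measureReal_def, Real.volume_Ioc,
    ENNReal.toReal_ofReal', overlap, max_comm]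
  intro x hx
  exact ⟨(NNReal.coe_nonneg _).trans hx.1.1.le, hx.1.2.trans (H.le_horizon _)⟩

theorem integrable_bracket (H H' : SimpleProcess ι P ℱ T) : Integrable (H.bracket H') P := by
  refine integrable_finsetSum _ fun k _ => integrable_finsetSum _ fun l _ => ?_
  refine Integrable.const_mul ?_ _
  refine ((((H.memLp k).norm).integrable_mul ((H'.memLp l).norm))).mono
    ((H.memLp k).1.inner (H'.memLp l).1) (ae_of_all _ fun ω => ?_)
  simpa using abs_real_inner_le_norm (H.coeff k ω) (H'.coeff l ω)

theorem norm_value_sub_sq (H H' : SimpleProcess ι P ℱ T) (s : ℝ) (ω : Ω) :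
    ‖H.value s.toNNReal ω - H'.value s.toNNReal ω‖ ^ 2 =
      inner ℝ (H.value s.toNNReal ω) (H.value s.toNNReal ω) -
        2 * inner ℝ (H.value s.toNNReal ω) (H'.value s.toNNReal ω) +
        inner ℝ (H'.value s.toNNReal ω) (H'.value s.toNNReal ω) := by
  rw [norm_sub_sq_real, real_inner_self_eq_norm_sq, real_inner_self_eq_norm_sq]

theorem integral_norm_value_sub_sq (H H' : SimpleProcess ι P ℱ T) (ω : Ω) :
    ∫ s in Set.Icc (0 : ℝ) T, ‖H.value s.toNNReal ω - H'.value s.toNNReal ω‖ ^ 2 =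
      H.bracket H ω - 2 * H.bracket H' ω + H'.bracket H' ω := by
  simp only [norm_value_sub_sq, ← integral_inner_value]
  exact integral_sub_two_mul_add (H.integrable_inner_value H ω) (H.integrable_inner_value H' ω)
    (H'.integrable_inner_value H' ω)

theorem bracket_sub_nonneg (H H' : SimpleProcess ι P ℱ T) (ω : Ω) :
    0 ≤ H.bracket H ω - 2 * H.bracket H' ω + H'.bracket H' ω := by
  rw [← integral_norm_value_sub_sq]
  exact integral_nonneg fun s => by positivity

theorem lintegral_value_sub (H H' : SimpleProcess ι P ℱ T) (ω : Ω) :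
    ∫⁻ s in Set.Icc (0 : ℝ) T, ‖H.value s.toNNReal ω - H'.value s.toNNReal ω‖ₑ ^ 2 =
      ENNReal.ofReal (H.bracket H ω - 2 * H.bracket H' ω + H'.bracket H' ω) := by
  rw [← integral_norm_value_sub_sq, ofReal_integral_eq_lintegral_ofReal]
  · refine lintegral_congr fun s => ?_
    rw [ENNReal.ofReal_pow (norm_nonneg _), ofReal_norm]
  · simp only [norm_value_sub_sq]
    exact integrable_sub_two_mul_add (H.integrable_inner_value H ω)
      (H.integrable_inner_value H' ω) (H'.integrable_inner_value H' ω)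
  · exact ae_of_all _ fun s => by positivity

theorem overlap_self_time (H : SimpleProcess ι P ℱ T) (k : ℕ) :
    overlap (H.time k) (H.time (k + 1)) (H.time k) (H.time (k + 1)) =
      H.time (k + 1) - H.time k := by
  have : (H.time k : ℝ) ≤ H.time (k + 1) := H.mono k.le_succ
  rw [overlap, min_self, max_self, max_eq_right (by linarith)]

theorem overlap_time_of_ne (H : SimpleProcess ι P ℱ T) {k l : ℕ} (h : k ≠ l) :
    overlap (H.time k) (H.time (k + 1)) (H.time l) (H.time (l + 1)) = 0 := by
  wlog hkl : k < l generalizing k l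
  · rw [overlap_comm, this h.symm (by omega)]
  have : (H.time (k + 1) : ℝ) ≤ H.time l := H.mono (by omega)
  refine max_eq_left ?_
  linarith [min_le_left (H.time (k + 1) : ℝ) (H.time (l + 1)),
    le_max_right (H.time k : ℝ) (H.time l)]

theorem bracket_self (H : SimpleProcess ι P ℱ T) (ω : Ω) :
    H.bracket H ω = ∑ k ∈ Finset.range H.num,
      ((H.time (k + 1) : ℝ) - H.time k) * ‖H.coeff k ω‖ ^ 2 := by
  refine Finset.sum_congr rfl fun k hk => ?_
  rw [Finset.sum_eq_single_of_mem k hk fun l _ hl => by rw [H.overlap_time_of_ne hl.symm, zero_mul],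
    overlap_self_time, real_inner_self_eq_norm_sq]

theorem energy_value (H : SimpleProcess ι P ℱ T) (ω : Ω) :
    energy T H.value ω = H.bracket H ω := by
  rw [← integral_inner_value]
  exact integral_congr_ae (ae_of_all _ fun s => (real_inner_self_eq_norm_sq _).symm)

end General

variable {W : ι → ℝ≥0 → Ω → ℝ} {hWm : ∀ i t, Measurable (W i t)}

theorem integral_measurable (H : SimpleProcess ι P (generatedFiltration P W hWm) T) :
    Measurable[generatedFiltration P W hWm T] (H.integral W) := by
  refine Finset.measurable_fun_sum _ fun k _ => Finset.measurable_fun_sum _ fun i _ => ?_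
  exact ((H.coord_measurable k i).mono ((generatedFiltration P W hWm).mono (H.le_horizon k))
    le_rfl).mul (generatedFiltration_measurable_increment i (H.le_horizon k) (H.le_horizon _))

variable [IsProbabilityMeasure P]

theorem memLp_integral (hW : IsBrownianFamilyOn P T W)
    (H : SimpleProcess ι P (generatedFiltration P W hWm) T) : MemLp (H.integral W) 2 P :=
  memLp_finsetSum _ fun k _ => memLp_finsetSum _ fun i _ =>
    hW.memLp_mul_increment (H.mono k.le_succ) (H.le_horizon _) i (H.coord_measurable k i)
      (H.coord_memLp k i)

theorem integral_integral_mul (hW : IsBrownianFamilyOn P T W)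
    (H H' : SimpleProcess ι P (generatedFiltration P W hWm) T) :
    ∫ ω, H.integral W ω * H'.integral W ω ∂P = ∫ ω, H.bracket H' ω ∂P := by
  classical
  have hM : ∀ (H : SimpleProcess ι P (generatedFiltration P W hWm) T) k i,
      MemLp (fun ω => H.coeff k ω i * brownianIncrement W i (H.time k) (H.time (k + 1)) ω) 2 P :=
    fun H k i => hW.memLp_mul_increment (H.mono k.le_succ) (H.le_horizon _) i
      (H.coord_measurable k i) (H.coord_memLp k i)
  have hI : ∀ k l i j, Integrable (fun ω =>
      (H.coeff k ω i * brownianIncrement W i (H.time k) (H.time (k + 1)) ω) *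
      (H'.coeff l ω j * brownianIncrement W j (H'.time l) (H'.time (l + 1)) ω)) P :=
    fun k l i j => (hM H k i).integrable_mul (hM H' l j)
  have hJ : ∀ k l i j, Integrable (fun ω =>
      overlap (H.time k) (H.time (k + 1)) (H'.time l) (H'.time (l + 1)) *
      (if i = j then H.coeff k ω i * H'.coeff l ω j else 0)) P := by
    intro k l i j
    refine Integrable.const_mul ?_ _
    split_ifs
    · exact (H.coord_memLp k i).integrable_mul (H'.coord_memLp l j)
    · exact integrable_zero _ _ _
  have e1 : ∀ ω, H.integral W ω * H'.integral W ω =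
      ∑ k ∈ Finset.range H.num, ∑ l ∈ Finset.range H'.num, ∑ i ∈ H.support, ∑ j ∈ H'.support,
        (H.coeff k ω i * brownianIncrement W i (H.time k) (H.time (k + 1)) ω) *
        (H'.coeff l ω j * brownianIncrement W j (H'.time l) (H'.time (l + 1)) ω) := by
    intro ω
    rw [integral, integral, Finset.sum_mul_sum]
    refine Finset.sum_congr rfl fun k _ => Finset.sum_congr rfl fun l _ => ?_
    rw [Finset.sum_mul_sum]
    rfl
  have e2 : ∀ ω, H.bracket H' ω =
      ∑ k ∈ Finset.range H.num, ∑ l ∈ Finset.range H'.num, ∑ i ∈ H.support, ∑ j ∈ H'.support,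
        overlap (H.time k) (H.time (k + 1)) (H'.time l) (H'.time (l + 1)) *
          (if i = j then H.coeff k ω i * H'.coeff l ω j else 0) := by
    intro ω
    refine Finset.sum_congr rfl fun k _ => Finset.sum_congr rfl fun l _ => ?_
    rw [Ell2.inner_eq_sum_sum (H.coeff_eq_zero k ω) (H'.coeff_eq_zero l ω), Finset.mul_sum]
    exact Finset.sum_congr rfl fun i _ => Finset.mul_sum _ _ _
  simp only [e1, e2]
  rw [integral_finsetSum _ fun k _ => integrable_finsetSum _ fun l _ => integrable_finsetSum _
      fun i _ => integrable_finsetSum _ fun j _ => hI k l i j,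
    integral_finsetSum _ fun k _ => integrable_finsetSum _ fun l _ => integrable_finsetSum _
      fun i _ => integrable_finsetSum _ fun j _ => hJ k l i j]
  refine Finset.sum_congr rfl fun k _ => ?_
  rw [integral_finsetSum _ fun l _ => integrable_finsetSum _
      fun i _ => integrable_finsetSum _ fun j _ => hI k l i j,
    integral_finsetSum _ fun l _ => integrable_finsetSum _
      fun i _ => integrable_finsetSum _ fun j _ => hJ k l i j]
  refine Finset.sum_congr rfl fun l _ => ?_
  rw [integral_finsetSum _ fun i _ => integrable_finsetSum _ fun j _ => hI k l i j,
    integral_finsetSum _ fun i _ => integrable_finsetSum _ fun j _ => hJ k l i j]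
  refine Finset.sum_congr rfl fun i _ => ?_
  rw [integral_finsetSum _ fun j _ => hI k l i j, integral_finsetSum _ fun j _ => hJ k l i j]
  refine Finset.sum_congr rfl fun j _ => ?_
  rw [hW.integral_elementary_mul i j (H.mono k.le_succ) (H.le_horizon _) (H'.mono l.le_succ)
    (H'.le_horizon _) (H.coord_measurable k i) (H.coord_memLp k i) (H'.coord_measurable l j)
    (H'.coord_memLp l j), integral_const_mul]
  split_ifs <;> simp

/-- The Itô isometry for the difference of two simple processes. -/
theorem lintegral_integral_sub (hW : IsBrownianFamilyOn P T W)
    (H H' : SimpleProcess ι P (generatedFiltration P W hWm) T) :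
    ∫⁻ ω, ‖H.integral W ω - H'.integral W ω‖ₑ ^ 2 ∂P =
      ∫⁻ ω, ∫⁻ s in Set.Icc (0 : ℝ) T,
        ‖H.value s.toNNReal ω - H'.value s.toNNReal ω‖ₑ ^ 2 ∂volume ∂P := by
  have m := H.memLp_integral hW
  have m' := H'.memLp_integral hW
  have i1 := m.integrable_mul m
  have i2 := m.integrable_mul m'
  have i3 := m'.integrable_mul m'
  have e : ∀ ω, ‖H.integral W ω - H'.integral W ω‖ₑ ^ 2 = ENNReal.ofReal
      ((H.integral W * H.integral W) ω - 2 * (H.integral W * H'.integral W) ω +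
        (H'.integral W * H'.integral W) ω) := by
    intro ω
    rw [← ofReal_norm, ← ENNReal.ofReal_pow (norm_nonneg _), Real.norm_eq_abs, sq_abs]
    congr 1
    simp only [Pi.mul_apply]
    ring
  simp only [lintegral_value_sub, e]
  rw [← ofReal_integral_eq_lintegral_ofReal (integrable_sub_two_mul_add
      (H.integrable_bracket H) (H.integrable_bracket H') (H'.integrable_bracket H'))
      (ae_of_all _ (H.bracket_sub_nonneg H')),
    ← ofReal_integral_eq_lintegral_ofReal (integrable_sub_two_mul_add i1 i2 i3),
    integral_sub_two_mul_add i1 i2 i3, integral_sub_two_mul_add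
      (H.integrable_bracket H) (H.integrable_bracket H') (H'.integrable_bracket H')]
  · simp only [Pi.mul_apply, integral_integral_mul hW]
  · refine ae_of_all _ fun ω => ?_
    simp only [Pi.mul_apply, Pi.zero_apply]
    nlinarith [sq_nonneg (H.integral W ω - H'.integral W ω)]

end SimpleProcess

/-! ### Exponentials of simple stochastic integrals -/

section Exponential

theorem lintegral_exp_gaussianReal (c : ℝ) (v : ℝ≥0) :
    ∫⁻ y, ENNReal.ofReal (Real.exp (c * y - c ^ 2 / 2 * v)) ∂(gaussianReal 0 v) = 1 := by
  have h := congrFun (mgf_fun_id_gaussianReal (μ := 0) (v := v)) c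
  rw [mgf] at h
  simp only [sub_eq_add_neg, Real.exp_add]
  rw [← ofReal_integral_eq_lintegral_ofReal ((integrable_exp_mul_gaussianReal c).mul_const _)
    (ae_of_all _ fun y => by positivity), integral_mul_const, h, ← Real.exp_add]
  ring_nf
  simp

variable {Ω ι : Type*} [mΩ : MeasurableSpace Ω] {P : Measure Ω} {T : ℝ≥0}
  {W : ι → ℝ≥0 → Ω → ℝ} {hWm : ∀ i t, Measurable (W i t)}

theorem IsBrownianFamilyOn.lintegral_exp_sum_increment (hW : IsBrownianFamilyOn P T W)
    (hWm : ∀ i t, Measurable (W i t)) {s t : ℝ≥0} (hst : s ≤ t) (ht : t ≤ T) (S : Finset ι)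
    (c : S → ℝ) :
    ∫⁻ ω, ENNReal.ofReal (Real.exp (∑ i : S, (c i * brownianIncrement W i s t ω -
      c i ^ 2 / 2 * (t - s : ℝ≥0)))) ∂P = 1 := by
  have hind : iIndepFun (fun (i : S) ω => ENNReal.ofReal (Real.exp
      (c i * brownianIncrement W i s t ω - c i ^ 2 / 2 * (t - s : ℝ≥0)))) P :=
    (hW.indep.precomp (g := ((↑) : S → ι)) Subtype.val_injective).comp
      (fun i x => ENNReal.ofReal (Real.exp
        (c i * (x ⟨t, ht⟩ - x ⟨s, hst.trans ht⟩) - c i ^ 2 / 2 * (t - s : ℝ≥0))))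
      (fun _ => by fun_prop)
  simp only [Real.exp_sum]
  have hm : ∀ i, Measurable (brownianIncrement W i s t) :=
    fun i => measurable_brownianIncrement hWm i s t
  have e := lintegral_prod_eq_prod_lintegral_of_indepFun Finset.univ _ hind
    (fun i => by have := hm i; fun_prop)
  refine Eq.trans ?_ (e.trans (Finset.prod_eq_one fun i _ => ?_))
  · exact lintegral_congr fun ω => ENNReal.ofReal_prod_of_nonneg fun i _ => (Real.exp_pos _).le
  · have hl : HasLaw (brownianIncrement W i s t) _ P := (hW.brownian i).law s t hst ht
    rw [← lintegral_exp_gaussianReal (c i) (t - s), ← hl.map_eq, lintegral_map (by fun_prop)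
      (hm i)]

namespace SimpleProcess

/-- The logarithm of the exponential martingale of `q • H`, restricted to the first `n` intervals
of the subdivision. -/
def logExp (H : SimpleProcess ι P (generatedFiltration P W hWm) T) (q : ℝ) (n : ℕ) (ω : Ω) : ℝ :=
  ∑ k ∈ Finset.range n, ∑ i : H.support,
    (q * H.coeff k ω i * brownianIncrement W i (H.time k) (H.time (k + 1)) ω -
      (q * H.coeff k ω i) ^ 2 / 2 * (H.time (k + 1) - H.time k : ℝ≥0))

theorem logExp_measurable (H : SimpleProcess ι P (generatedFiltration P W hWm) T) (q : ℝ) (n : ℕ) :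
    Measurable[generatedFiltration P W hWm (H.time n)] (H.logExp q n) := by
  refine Finset.measurable_fun_sum _ fun k hk => Finset.measurable_fun_sum _ fun i _ => ?_
  have hkn : k + 1 ≤ n := Finset.mem_range.1 hk
  have h1 : Measurable[generatedFiltration P W hWm (H.time n)] (fun ω => H.coeff k ω i) :=
    (H.coord_measurable k i).mono
      ((generatedFiltration P W hWm).mono (H.mono (k.le_succ.trans hkn))) le_rfl
  have h2 : Measurable[generatedFiltration P W hWm (H.time n)]
      (brownianIncrement W i (H.time k) (H.time (k + 1))) :=
    generatedFiltration_measurable_increment (i : ι) (H.mono (k.le_succ.trans hkn)) (H.mono hkn)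
  fun_prop

/-- In the induction step the coefficients on the last interval and all earlier factors are
independent of the last increments. Integrating over the latter first gives the factor one, by the
Laplace transform of the Gaussian distribution. -/
theorem lintegral_exp_logExp [IsProbabilityMeasure P] (hW : IsBrownianFamilyOn P T W)
    (H : SimpleProcess ι P (generatedFiltration P W hWm) T) (q : ℝ) (n : ℕ) :
    ∫⁻ ω, ENNReal.ofReal (Real.exp (H.logExp q n ω)) ∂P = 1 := by
  induction n with
  | zero => simp [logExp]
  | succ n ih =>
    let V : Ω → ℝ × (H.support → ℝ) := fun ω => (H.logExp q n ω, fun i => H.coeff n ω i)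
    let Y : Ω → H.support → ℝ := fun ω i =>
      brownianIncrement W i (H.time n) (H.time (n + 1)) ω
    let G : (ℝ × (H.support → ℝ)) × (H.support → ℝ) → ℝ≥0∞ := fun p =>
      ENNReal.ofReal (Real.exp (p.1.1 + ∑ i, (q * p.1.2 i * p.2 i -
        (q * p.1.2 i) ^ 2 / 2 * (H.time (n + 1) - H.time n : ℝ≥0))))
    have hG : Measurable G := by fun_prop
    have hV : Measurable[generatedFiltration P W hWm (H.time n)] V :=
      (H.logExp_measurable q n).prodMk
        (@measurable_pi_lambda _ _ _ (_) _ _ fun i => H.coord_measurable n i)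
    have hV' : Measurable V := hV.mono ((generatedFiltration P W hWm).le _) le_rfl
    have hY : Measurable Y :=
      measurable_pi_lambda _ fun i => measurable_brownianIncrement hWm i _ _
    have hind : IndepFun V Y P := hW.indepFun_increment (H.le_horizon n) hV
      (φ := fun (x : ι × Set.Icc (H.time n) T → ℝ) (i : H.support) =>
        x (i.1, (⟨H.time (n + 1), H.mono n.le_succ, H.le_horizon _⟩ : Set.Icc (H.time n) T)))
      (measurable_pi_lambda _ fun i => measurable_pi_apply _)
    have e1 : ∀ ω, ENNReal.ofReal (Real.exp (H.logExp q (n + 1) ω)) = G (V ω, Y ω) := by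
      intro ω
      simp only [logExp, Finset.sum_range_succ, G, V, Y]
    have e2 : ∀ v, ∫⁻ y, G (v, y) ∂(P.map Y) = ENNReal.ofReal (Real.exp v.1) := by
      intro v
      have hGv : Measurable fun y => G (v, y) := hG.comp measurable_prodMk_left
      rw [lintegral_map hGv hY]
      have := hW.lintegral_exp_sum_increment hWm (H.mono n.le_succ) (H.le_horizon (n + 1))
        H.support (fun i => q * v.2 i)
      rw [← mul_one (ENNReal.ofReal (Real.exp v.1)), ← this, ← lintegral_const_mul]
      · refine lintegral_congr fun ω => ?_
        rw [← ENNReal.ofReal_mul (Real.exp_pos _).le, ← Real.exp_add]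
      · have hm : ∀ i, Measurable (brownianIncrement W i (H.time n) (H.time (n + 1))) :=
          fun i => measurable_brownianIncrement hWm i _ _
        fun_prop
    simp only [e1]
    rw [← lintegral_map (f := G) (g := fun ω => (V ω, Y ω)) hG (hV'.prodMk hY),
      (indepFun_iff_map_prod_eq_prod_map_map hV'.aemeasurable hY.aemeasurable).1 hind]
    have : IsProbabilityMeasure (P.map Y) := Measure.isProbabilityMeasure_map hY.aemeasurable
    rw [lintegral_prod _ hG.aemeasurable]
    simp only [e2]
    rw [lintegral_map (by fun_prop) hV', ← ih]

/-- The exponential `exp (q ∫ H dW - q² / 2 ∫ ‖H‖² dt)` of a simple process has mean one. -/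
theorem lintegral_exp [IsProbabilityMeasure P] (hW : IsBrownianFamilyOn P T W)
    (H : SimpleProcess ι P (generatedFiltration P W hWm) T) (q : ℝ) :
    ∫⁻ ω, ENNReal.ofReal (Real.exp (q * H.integral W ω - q ^ 2 / 2 * H.bracket H ω)) ∂P = 1 := by
  rw [← H.lintegral_exp_logExp hW q H.num]
  refine lintegral_congr fun ω => ?_
  congr 2
  rw [bracket_self, integral, logExp, Finset.mul_sum, Finset.mul_sum, ← Finset.sum_sub_distrib]
  refine Finset.sum_congr rfl fun k _ => ?_
  rw [Ell2.norm_sq_eq_sum (H.coeff_eq_zero k ω), Finset.mul_sum, Finset.mul_sum, Finset.mul_sum,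
    ← Finset.sum_sub_distrib, ← Finset.sum_coe_sort]
  refine Finset.sum_congr rfl fun i _ => ?_
  rw [NNReal.coe_sub (H.mono k.le_succ), brownianIncrement]
  ring

end SimpleProcess

end Exponential

/-! ### Approximation of square integrable paths by step functions -/

section Approximation

theorem sq_lintegral_le {α : Type*} [MeasurableSpace α] {μ : Measure α} {g : α → ℝ≥0∞}
    (hg : AEMeasurable g μ) :
    (∫⁻ x, g x ∂μ) ^ 2 ≤ μ Set.univ * ∫⁻ x, g x ^ 2 ∂μ := by
  have h := ENNReal.lintegral_mul_le_Lp_mul_Lq μ Real.HolderConjugate.two_two hg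
    (aemeasurable_const (b := (1 : ℝ≥0∞)))
  simp only [Pi.mul_apply, mul_one, ENNReal.one_rpow, lintegral_const, one_mul] at h
  calc (∫⁻ x, g x ∂μ) ^ 2
      ≤ ((∫⁻ x, g x ^ (2 : ℝ) ∂μ) ^ (1 / 2 : ℝ) * μ Set.univ ^ (1 / 2 : ℝ)) ^ 2 := by gcongr
    _ = μ Set.univ * ∫⁻ x, g x ^ 2 ∂μ := by
      rw [mul_pow, ← ENNReal.rpow_natCast, ← ENNReal.rpow_natCast, ← ENNReal.rpow_mul,
        ← ENNReal.rpow_mul, mul_comm]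
      norm_num

theorem enorm_sub_sq_le {E : Type*} [NormedAddCommGroup E] (x y : E) :
    ‖x - y‖ₑ ^ 2 ≤ 2 * ‖x‖ₑ ^ 2 + 2 * ‖y‖ₑ ^ 2 := by
  have h1 : ‖x - y‖ ^ 2 ≤ 2 * ‖x‖ ^ 2 + 2 * ‖y‖ ^ 2 := by
    have := norm_sub_le x y
    nlinarith [sq_nonneg (‖x‖ - ‖y‖), norm_nonneg (x - y)]
  have h2 := ENNReal.ofReal_le_ofReal h1
  rwa [ENNReal.ofReal_add (by positivity) (by positivity), ENNReal.ofReal_mul (by norm_num),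
    ENNReal.ofReal_mul (by norm_num), ENNReal.ofReal_pow (norm_nonneg _),
    ENNReal.ofReal_pow (norm_nonneg _), ENNReal.ofReal_pow (norm_nonneg _), ofReal_norm,
    ofReal_norm, ofReal_norm, ENNReal.ofReal_ofNat] at h2

/-- A sequence that converges almost everywhere and whose `L²` norms do not exceed the norm of the
limit converges in `L²`. -/
theorem tendsto_lintegral_enorm_sub_sq {α E : Type*} [MeasurableSpace α] {μ : Measure α}
    [NormedAddCommGroup E] {g : ℕ → α → E} {f : α → E} (hg : ∀ n, AEStronglyMeasurable (g n) μ)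
    (hf : AEStronglyMeasurable f μ) (hfi : ∫⁻ x, ‖f x‖ₑ ^ 2 ∂μ ≠ ⊤)
    (hle : ∀ n, ∫⁻ x, ‖g n x‖ₑ ^ 2 ∂μ ≤ ∫⁻ x, ‖f x‖ₑ ^ 2 ∂μ)
    (hlim : ∀ᵐ x ∂μ, Tendsto (fun n => g n x) atTop (𝓝 (f x))) :
    Tendsto (fun n => ∫⁻ x, ‖g n x - f x‖ₑ ^ 2 ∂μ) atTop (𝓝 0) := by
  set I := ∫⁻ x, ‖f x‖ₑ ^ 2 ∂μ with hI
  have hgm : ∀ n, AEMeasurable (fun x => ‖g n x‖ₑ) μ := fun n => (hg n).enorm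
  have hfm : AEMeasurable (fun x => ‖f x‖ₑ) μ := hf.enorm
  have hdm : ∀ n, AEMeasurable (fun x => ‖g n x - f x‖ₑ) μ := fun n => ((hg n).sub hf).enorm
  -- Fatou's lemma applies to these functions, which are nonnegative by `enorm_sub_sq_le`
  let φ : ℕ → α → ℝ≥0∞ := fun n x => 2 * ‖g n x‖ₑ ^ 2 + 2 * ‖f x‖ₑ ^ 2 - ‖g n x - f x‖ₑ ^ 2
  have hφm : ∀ n, AEMeasurable (φ n) μ := fun n => by
    have := hgm n; have := hdm n
    fun_prop
  have hpar : ∀ n x, ‖g n x - f x‖ₑ ^ 2 ≤ 2 * ‖g n x‖ₑ ^ 2 + 2 * ‖f x‖ₑ ^ 2 := fun n x =>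
    enorm_sub_sq_le _ _
  have hsum : ∀ n, ∫⁻ x, φ n x ∂μ + ∫⁻ x, ‖g n x - f x‖ₑ ^ 2 ∂μ ≤ 4 * I := by
    intro n
    rw [← lintegral_add_left' (hφm n)]
    calc ∫⁻ x, (φ n x + ‖g n x - f x‖ₑ ^ 2) ∂μ
        = ∫⁻ x, (2 * ‖g n x‖ₑ ^ 2 + 2 * ‖f x‖ₑ ^ 2) ∂μ :=
          lintegral_congr fun x => tsub_add_cancel_of_le (hpar n x)
      _ = 2 * ∫⁻ x, ‖g n x‖ₑ ^ 2 ∂μ + 2 * I := by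
          have := hgm n
          rw [lintegral_add_left' (by fun_prop), lintegral_const_mul'' _ (by fun_prop),
            lintegral_const_mul'' _ (by fun_prop)]
      _ ≤ 2 * I + 2 * I := by gcongr; exact hle n
      _ = 4 * I := by rw [← add_mul]; norm_num
  have h4 : 4 * I ≠ ⊤ := ENNReal.mul_ne_top (by norm_num) hfi
  have hφlim : ∀ᵐ x ∂μ, Tendsto (fun n => φ n x) atTop (𝓝 (4 * ‖f x‖ₑ ^ 2)) := by
    filter_upwards [hlim] with x hx
    have h1 : Tendsto (fun n => ‖g n x‖ₑ ^ 2) atTop (𝓝 (‖f x‖ₑ ^ 2)) :=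
      ENNReal.Tendsto.pow hx.enorm
    have h2 : Tendsto (fun n => ‖g n x - f x‖ₑ ^ 2) atTop (𝓝 0) := by
      have : Tendsto (fun n => g n x - f x) atTop (𝓝 0) := by
        simpa using hx.sub_const (f x)
      simpa using ENNReal.Tendsto.pow (n := 2) this.enorm
    have h3 := ENNReal.Tendsto.const_mul (a := 2) h1 (Or.inr (by norm_num))
    have h5 := ENNReal.Tendsto.sub (h3.add_const (2 * ‖f x‖ₑ ^ 2)) h2 (Or.inr (by simp))
    rw [tsub_zero, ← add_mul] at h5
    norm_num at h5
    exact h5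
  have hfatou : 4 * I ≤ liminf (fun n => ∫⁻ x, φ n x ∂μ) atTop := by
    calc 4 * I = ∫⁻ x, 4 * ‖f x‖ₑ ^ 2 ∂μ := (lintegral_const_mul'' _ (by fun_prop)).symm
      _ = ∫⁻ x, liminf (fun n => φ n x) atTop ∂μ := by
          refine lintegral_congr_ae ?_
          filter_upwards [hφlim] with x hx using hx.liminf_eq.symm
      _ ≤ _ := lintegral_liminf_le' hφm
  have hlim2 : Tendsto (fun n => ∫⁻ x, φ n x ∂μ) atTop (𝓝 (4 * I)) := by
    refine tendsto_of_le_liminf_of_limsup_le hfatou ?_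
    refine limsup_le_of_le (by isBoundedDefault) (Eventually.of_forall fun n => ?_)
    exact le_self_add.trans (hsum n)
  have hz : Tendsto (fun n => 4 * I - ∫⁻ x, φ n x ∂μ) atTop (𝓝 0) := by
    have := ENNReal.Tendsto.sub (tendsto_const_nhds (x := 4 * I)) hlim2 (Or.inl h4)
    simpa using this
  refine tendsto_of_tendsto_of_tendsto_of_le_of_le tendsto_const_nhds hz (fun n => zero_le)
    fun n => ?_
  refine ENNReal.le_sub_of_add_le_left (ne_top_of_le_ne_top h4 (le_self_add.trans (hsum n))) ?_
  exact hsum n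

/-- The subdivision of `[0, T]` with mesh `1 / (n + 1)`. -/
def gridTime (T : ℝ≥0) (n k : ℕ) : ℝ≥0 := min (k / (n + 1)) T

theorem gridTime_mono (T : ℝ≥0) (n : ℕ) : Monotone (gridTime T n) := fun k l h => by
  unfold gridTime
  gcongr

theorem gridTime_le (T : ℝ≥0) (n k : ℕ) : gridTime T n k ≤ T := min_le_right _ _

theorem gridTime_zero (T : ℝ≥0) (n : ℕ) : gridTime T n 0 = 0 := by simp [gridTime]

theorem gridTime_coe (T : ℝ≥0) (n k : ℕ) : (gridTime T n k : ℝ) = min ((k : ℝ) / (n + 1)) T := by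
  simp [gridTime]

theorem gridTime_succ_sub_le (T : ℝ≥0) (n k : ℕ) :
    (gridTime T n (k + 1) : ℝ) - gridTime T n k ≤ 1 / (n + 1) := by
  rw [gridTime_coe, gridTime_coe, Nat.cast_succ, add_div]
  have h : (0 : ℝ) ≤ 1 / (n + 1) := by positivity
  rcases le_total ((k : ℝ) / (n + 1)) T with h1 | h1
  · rw [min_eq_left h1]
    linarith [min_le_left ((k : ℝ) / (n + 1) + 1 / (n + 1)) (T : ℝ)]
  · rw [min_eq_right h1]
    linarith [min_le_right ((k : ℝ) / (n + 1) + 1 / (n + 1)) (T : ℝ)]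

variable {E : Type*} [NormedAddCommGroup E] [NormedSpace ℝ E]

/-- The average of `f` over the interval of the subdivision that precedes the `k`-th one. The
factor is the inverse mesh, also for the last interval, which may be shorter. For `k = 0` the
interval is empty. -/
def gridAverage (T : ℝ≥0) (n : ℕ) (f : ℝ → E) (k : ℕ) : E :=
  ((n : ℝ) + 1) • ∫ s in Set.Ioc (gridTime T n (k - 1) : ℝ) (gridTime T n k), f s

theorem gridAverage_enorm_sq_le (T : ℝ≥0) (n : ℕ) {f : ℝ → E}
    (hf : AEStronglyMeasurable f (volume.restrict (Set.Icc (0 : ℝ) T))) (k : ℕ) :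
    ‖gridAverage T n f k‖ₑ ^ 2 ≤ ENNReal.ofReal (n + 1) *
      ∫⁻ s in Set.Ioc (gridTime T n (k - 1) : ℝ) (gridTime T n k), ‖f s‖ₑ ^ 2 := by
  have hsub : Set.Ioc (gridTime T n (k - 1) : ℝ) (gridTime T n k) ⊆ Set.Icc (0 : ℝ) T :=
    fun x hx => ⟨(NNReal.coe_nonneg _).trans hx.1.le, hx.2.trans (gridTime_le T n k)⟩
  have hfm := (hf.mono_measure (Measure.restrict_mono hsub le_rfl)).enorm
  have h1 := sq_lintegral_le hfm
  have hvol : volume.restrict (Set.Ioc (gridTime T n (k - 1) : ℝ) (gridTime T n k)) Set.univ ≤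
      ENNReal.ofReal (1 / (n + 1)) := by
    rw [Measure.restrict_apply_univ, Real.volume_Ioc]
    refine ENNReal.ofReal_le_ofReal ?_
    rcases k with _ | k
    · simp only [Nat.zero_sub, sub_self]
      positivity
    · exact gridTime_succ_sub_le T n k
  have hn : (0 : ℝ) ≤ (n : ℝ) + 1 := by positivity
  have he : ‖(n : ℝ) + 1‖ₑ = ENNReal.ofReal (n + 1) := by
    rw [← ofReal_norm, Real.norm_of_nonneg hn]
  calc ‖gridAverage T n f k‖ₑ ^ 2
      ≤ (ENNReal.ofReal (n + 1) *
        ∫⁻ s in Set.Ioc (gridTime T n (k - 1) : ℝ) (gridTime T n k), ‖f s‖ₑ) ^ 2 := by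
        rw [gridAverage, enorm_smul, he]
        gcongr
        exact enorm_integral_le_lintegral_enorm _
    _ ≤ ENNReal.ofReal (n + 1) ^ 2 * (ENNReal.ofReal (1 / (n + 1)) *
        ∫⁻ s in Set.Ioc (gridTime T n (k - 1) : ℝ) (gridTime T n k), ‖f s‖ₑ ^ 2) := by
        rw [mul_pow]
        gcongr
        exact h1.trans (by gcongr)
    _ = _ := by
        rw [← mul_assoc]
        congr 1
        rw [← ENNReal.ofReal_pow hn, ← ENNReal.ofReal_mul (by positivity)]
        congr 1
        field_simp

theorem sum_gridAverage_le (T : ℝ≥0) (n : ℕ) {f : ℝ → E}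
    (hf : AEStronglyMeasurable f (volume.restrict (Set.Icc (0 : ℝ) T))) (m : ℕ) :
    ∑ k ∈ Finset.range m, ENNReal.ofReal ((gridTime T n (k + 1) : ℝ) - gridTime T n k) *
      ‖gridAverage T n f k‖ₑ ^ 2 ≤ ∫⁻ s in Set.Icc (0 : ℝ) T, ‖f s‖ₑ ^ 2 := by
  have h1 : ∀ k, ENNReal.ofReal ((gridTime T n (k + 1) : ℝ) - gridTime T n k) *
      ‖gridAverage T n f k‖ₑ ^ 2 ≤
      ∫⁻ s in Set.Ioc (gridTime T n (k - 1) : ℝ) (gridTime T n k), ‖f s‖ₑ ^ 2 := by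
    intro k
    calc _ ≤ ENNReal.ofReal (1 / (n + 1)) * (ENNReal.ofReal (n + 1) *
        ∫⁻ s in Set.Ioc (gridTime T n (k - 1) : ℝ) (gridTime T n k), ‖f s‖ₑ ^ 2) := by
          gcongr
          · exact gridTime_succ_sub_le T n k
          · exact gridAverage_enorm_sq_le T n hf k
      _ = _ := by
          rw [← mul_assoc, ← ENNReal.ofReal_mul (by positivity), one_div_mul_cancel (by positivity),
            ENNReal.ofReal_one, one_mul]
  have h2 : ∀ m, ∑ k ∈ Finset.range m,
      ∫⁻ s in Set.Ioc (gridTime T n (k - 1) : ℝ) (gridTime T n k), ‖f s‖ₑ ^ 2 =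
      ∫⁻ s in Set.Ioc (0 : ℝ) (gridTime T n (m - 1)), ‖f s‖ₑ ^ 2 := by
    intro m
    induction m with
    | zero => simp [gridTime_zero]
    | succ m ih =>
      rw [Finset.sum_range_succ, ih, ← lintegral_union measurableSet_Ioc
        (Set.Ioc_disjoint_Ioc_of_le le_rfl), Set.Ioc_union_Ioc_eq_Ioc (NNReal.coe_nonneg _)
        (NNReal.coe_le_coe.2 (gridTime_mono T n (Nat.sub_le m 1)))]
      rfl
  refine (Finset.sum_le_sum fun k _ => h1 k).trans ((h2 m).le.trans ?_)
  exact lintegral_mono_set fun x hx => ⟨hx.1.le, hx.2.trans (gridTime_le T n _)⟩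

/-- The number of the interval of the subdivision with mesh `1 / (n + 1)` that contains `s`. -/
def gridIndex (n : ℕ) (s : ℝ) : ℕ := ⌈s * (n + 1)⌉₊ - 1

theorem mem_Ioc_gridIndex {n : ℕ} {s : ℝ} (hs : 0 < s) :
    (gridIndex n s : ℝ) / (n + 1) < s ∧ s ≤ ((gridIndex n s : ℝ) + 1) / (n + 1) := by
  have hn : (0 : ℝ) < n + 1 := by positivity
  have hp : 0 < ⌈s * (n + 1)⌉₊ := Nat.ceil_pos.2 (by positivity)
  have he : ((gridIndex n s : ℝ)) + 1 = (⌈s * (n + 1)⌉₊ : ℝ) := by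
    rw [gridIndex]
    exact_mod_cast Nat.sub_add_cancel hp
  rw [div_lt_iff₀ hn, le_div_iff₀ hn, he]
  have h2 := Nat.ceil_lt_add_one (a := s * ((n : ℝ) + 1)) (by positivity)
  exact ⟨by linarith, Nat.le_ceil _⟩

theorem mem_Ioc_gridTime {T : ℝ≥0} {n : ℕ} {s : ℝ} (hs : 0 < s) (hsT : s ≤ T) :
    s ∈ Set.Ioc (gridTime T n (gridIndex n s) : ℝ) (gridTime T n (gridIndex n s + 1)) := by
  obtain ⟨h1, h2⟩ := mem_Ioc_gridIndex (n := n) hs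
  rw [gridTime_coe, gridTime_coe, Nat.cast_succ]
  exact ⟨(min_le_left _ _).trans_lt h1, le_min h2 hsT⟩

/-- The averages over the preceding interval converge almost everywhere, by the Lebesgue
differentiation theorem. -/
theorem ae_tendsto_gridAverage [CompleteSpace E] (T : ℝ≥0) {f : ℝ → E}
    (hf : IntegrableOn f (Set.Icc (0 : ℝ) T)) :
    ∀ᵐ s ∂(volume.restrict (Set.Icc (0 : ℝ) T)),
      Tendsto (fun n => gridAverage T n f (gridIndex n s)) atTop (𝓝 (f s)) := by
  have hfl : LocallyIntegrable ((Set.Icc (0 : ℝ) T).indicator f) volume :=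
    ((integrable_indicator_iff measurableSet_Icc).2 hf).locallyIntegrable
  have h0 : ∀ᵐ s : ℝ, s ≠ 0 := by simp [ae_iff]
  rw [ae_restrict_iff' measurableSet_Icc]
  filter_upwards [IsUnifLocDoublingMeasure.ae_tendsto_average volume hfl 3, h0] with s hs hs0 hsI
  have hspos : 0 < s := lt_of_le_of_ne hsI.1 hs0.symm
  have hδ : Tendsto (fun n : ℕ => (1 / 2 : ℝ) * (1 / ((n : ℝ) + 1))) atTop (𝓝[>] 0) := by
    refine tendsto_nhdsWithin_iff.2 ⟨?_, Eventually.of_forall fun n => ?_⟩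
    · simpa using tendsto_one_div_add_atTop_nhds_zero_nat.const_mul (1 / 2 : ℝ)
    · exact Set.mem_Ioi.2 (by positivity)
  -- the preceding interval is a ball of radius half the mesh, and `s` lies in the concentric ball
  -- of three times this radius
  have := hs (l := atTop) (fun n : ℕ => ((gridIndex n s : ℝ) - 1 / 2) / (n + 1)) _ hδ
    (Eventually.of_forall fun n => by
      obtain ⟨h1, h2⟩ := mem_Ioc_gridIndex (n := n) hspos
      have h3 : (0 : ℝ) < 1 / (n + 1) := by positivity
      rw [Metric.mem_closedBall, Real.dist_eq, abs_le]
      rw [add_div] at h2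
      rw [sub_div]
      have h4 : (1 / 2 : ℝ) / (n + 1) = 1 / 2 * (1 / (n + 1)) := by ring
      rw [h4]
      constructor <;> linarith)
  rw [Set.indicator_of_mem hsI] at this
  refine this.congr' ?_
  have hev : ∀ᶠ n : ℕ in atTop, 1 < s * (n + 1) :=
    ((tendsto_natCast_atTop_atTop.atTop_add tendsto_const_nhds).const_mul_atTop
      hspos).eventually_gt_atTop 1
  filter_upwards [hev] with n hn
  obtain ⟨h1, h2⟩ := mem_Ioc_gridIndex (n := n) hspos
  have hk : 1 ≤ gridIndex n s := by
    have : (1 : ℕ) < ⌈s * (n + 1)⌉₊ := Nat.lt_ceil.2 (by simpa using hn)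
    unfold gridIndex
    omega
  have hnp : (0 : ℝ) < n + 1 := by positivity
  have e1 : (gridTime T n (gridIndex n s) : ℝ) = (gridIndex n s : ℝ) / (n + 1) := by
    rw [gridTime_coe, min_eq_left (h1.le.trans hsI.2)]
  have e2 : (gridTime T n (gridIndex n s - 1) : ℝ) = ((gridIndex n s : ℝ) - 1) / (n + 1) := by
    rw [gridTime_coe, Nat.cast_sub hk, Nat.cast_one, min_eq_left]
    refine le_trans ?_ (h1.le.trans hsI.2)
    gcongr
    linarith
  have hlow : 0 ≤ ((gridIndex n s : ℝ) - 1) / (n + 1) := by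
    have : (1 : ℝ) ≤ gridIndex n s := by exact_mod_cast hk
    exact div_nonneg (by linarith) hnp.le
  rw [setAverage_eq, gridAverage, e1, e2, Real.closedBall_eq_Icc]
  have e3 : ((gridIndex n s : ℝ) - 1 / 2) / (n + 1) - 1 / 2 * (1 / ((n : ℝ) + 1)) =
      ((gridIndex n s : ℝ) - 1) / (n + 1) := by field_simp; ring
  have e4 : ((gridIndex n s : ℝ) - 1 / 2) / (n + 1) + 1 / 2 * (1 / ((n : ℝ) + 1)) =
      (gridIndex n s : ℝ) / (n + 1) := by field_simp; ring
  rw [e3, e4, integral_Icc_eq_integral_Ioc]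
  congr 1
  · rw [measureReal_def, Real.volume_Icc, ENNReal.toReal_ofReal]
    · field_simp; ring
    · rw [← sub_div]; exact div_nonneg (by linarith) hnp.le
  · refine setIntegral_congr_fun measurableSet_Ioc fun x hx => ?_
    exact Set.indicator_of_mem (show x ∈ Set.Icc (0 : ℝ) T from
      ⟨hlow.trans hx.1.le, hx.2.trans (h1.le.trans hsI.2)⟩) f

end Approximation

/-! ### Approximation of progressive processes by simple processes -/

section Truncation

variable {ι : Type*}

open Classical in
/-- The truncation of a square summable family to the finitely many coordinates in `S`. -/
def Ell2.truncate (S : Finset ι) (x : Ell2 ι) : Ell2 ι :=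
  ∑ i ∈ S, x i • (lp.single 2 i (1 : ℝ) : Ell2 ι)

theorem Ell2.continuous_truncate (S : Finset ι) : Continuous (Ell2.truncate S) :=
  continuous_finsetSum _ fun i _ => (Ell2.continuous_apply i).smul continuous_const

theorem Ell2.truncate_apply_of_notMem {S : Finset ι} {i : ι} (hi : i ∉ S) (x : Ell2 ι) :
    Ell2.truncate S x i = 0 := by
  classical
  rw [truncate, lp.coeFn_sum, Finset.sum_apply]
  refine Finset.sum_eq_zero fun j hj => ?_
  have : i ≠ j := fun h => hi (h ▸ hj)
  simp [lp.single_apply, this]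

theorem Ell2.truncate_apply_of_mem {S : Finset ι} {i : ι} (hi : i ∈ S) (x : Ell2 ι) :
    Ell2.truncate S x i = x i := by
  classical
  rw [truncate, lp.coeFn_sum, Finset.sum_apply, Finset.sum_eq_single_of_mem i hi]
  · simp [lp.single_apply]
  · intro j _ hj
    simp [lp.single_apply, hj.symm]

theorem Ell2.norm_truncate_le (S : Finset ι) (x : Ell2 ι) : ‖Ell2.truncate S x‖ ≤ ‖x‖ := by
  refine le_of_sq_le_sq ?_ (norm_nonneg x)
  rw [Ell2.norm_sq_eq_sum (S := S) fun i hi => truncate_apply_of_notMem hi x]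
  have := lp.sum_rpow_le_norm_rpow (p := 2) (by norm_num) x S
  simp only [ENNReal.toReal_ofNat, Real.rpow_ofNat, Real.norm_eq_abs, sq_abs] at this
  refine (Finset.sum_le_sum fun i hi => ?_).trans this
  rw [truncate_apply_of_mem hi]

theorem Ell2.tendsto_truncate (x : Ell2 ι) :
    Tendsto (fun S => Ell2.truncate S x) atTop (𝓝 x) := by
  classical
  have h : HasSum (fun i => (lp.single 2 i (x i) : Ell2 ι)) x :=
    lp.hasSum_single (by norm_num) x
  have e : ∀ i, (lp.single 2 i (x i) : Ell2 ι) = x i • (lp.single 2 i (1 : ℝ) : Ell2 ι) := by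
    intro i
    ext j
    by_cases hj : j = i
    · subst hj; simp [lp.single_apply]
    · simp [lp.single_apply, hj]
  simp only [e] at h
  exact h

theorem Ell2.truncate_sub (S : Finset ι) (x y : Ell2 ι) :
    Ell2.truncate S (x - y) = Ell2.truncate S x - Ell2.truncate S y := by
  simp [truncate, sub_smul, Finset.sum_sub_distrib]

theorem Ell2.tendsto_truncate_of_tendsto {S : ℕ → Finset ι} (hS : Tendsto S atTop atTop)
    {x : ℕ → Ell2 ι} {y : Ell2 ι} (h : Tendsto x atTop (𝓝 y)) :
    Tendsto (fun n => Ell2.truncate (S n) (x n)) atTop (𝓝 y) := by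
  have h1 : Tendsto (fun n => Ell2.truncate (S n) (x n - y)) atTop (𝓝 0) := by
    refine squeeze_zero_norm (fun n => Ell2.norm_truncate_le _ _) ?_
    simpa using (h.sub_const y).norm
  have h2 := h1.add ((Ell2.tendsto_truncate y).comp hS)
  simpa [Ell2.truncate_sub] using h2

end Truncation

section Progressive

variable {Ω E : Type*} [NormedAddCommGroup E] {t : ℝ≥0} {γ : ℝ≥0 → Ω → E}

theorem stronglyMeasurable_stopped {m : MeasurableSpace Ω}
    (h : StronglyMeasurable fun p : Set.Iic t × Ω => γ p.1 p.2) :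
    StronglyMeasurable fun p : Ω × ℝ => γ (min p.2.toNNReal t) p.1 := by
  have hg : Measurable fun p : Ω × ℝ =>
      ((⟨min p.2.toNNReal t, Set.mem_Iic.2 (min_le_right _ _)⟩ : Set.Iic t), p.1) :=
    ((Measurable.subtype_mk (by fun_prop))).prodMk measurable_fst
  exact h.comp_measurable hg

theorem stronglyMeasurable_integral_progressive [NormedSpace ℝ E] {m : MeasurableSpace Ω}
    (h : StronglyMeasurable fun p : Set.Iic t × Ω => γ p.1 p.2) {a b : ℝ} (hb : b ≤ t) :
    StronglyMeasurable fun ω => ∫ s in Set.Ioc a b, γ s.toNNReal ω := by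
  have h1 := (stronglyMeasurable_stopped h).integral_prod_right'
    (ν := volume.restrict (Set.Ioc a b))
  convert! h1 using 2 with ω
  refine setIntegral_congr_fun measurableSet_Ioc fun s hs => ?_
  simp only
  rw [min_eq_left]
  exact Real.toNNReal_le_iff_le_coe.2 (hs.2.trans hb)

theorem min_toNNReal_of_mem_Icc {T : ℝ≥0} {s : ℝ} (hs : s ∈ Set.Icc (0 : ℝ) T) :
    min s.toNNReal T = s.toNNReal :=
  min_eq_left (Real.toNNReal_le_iff_le_coe.2 hs.2)

theorem aestronglyMeasurable_path {m : MeasurableSpace Ω}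
    (h : StronglyMeasurable fun p : Set.Iic t × Ω => γ p.1 p.2) (ω : Ω) :
    AEStronglyMeasurable (fun s : ℝ => γ s.toNNReal ω) (volume.restrict (Set.Icc (0 : ℝ) t)) := by
  have h1 : StronglyMeasurable fun s : ℝ => γ (min s.toNNReal t) ω :=
    (stronglyMeasurable_stopped h).comp_measurable measurable_prodMk_left
  refine h1.aestronglyMeasurable.congr ?_
  filter_upwards [ae_restrict_mem measurableSet_Icc] with s hs
  rw [min_toNNReal_of_mem_Icc hs]

theorem stronglyMeasurable_energy {ι : Type*} {γ : ℝ≥0 → Ω → Ell2 ι} {m : MeasurableSpace Ω}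
    (h : StronglyMeasurable fun p : Set.Iic t × Ω => γ p.1 p.2) :
    StronglyMeasurable (energy t γ) := by
  have h1 := ((stronglyMeasurable_stopped h).norm.pow 2).integral_prod_right'
    (ν := volume.restrict (Set.Icc (0 : ℝ) t))
  convert! h1 using 2 with ω
  refine setIntegral_congr_fun measurableSet_Icc fun s hs => ?_
  simp only [Pi.pow_apply]
  rw [min_toNNReal_of_mem_Icc hs]

end Progressive

theorem eLpNorm_two_sq {α E : Type*} [MeasurableSpace α] {μ : Measure α} [NormedAddCommGroup E]
    (f : α → E) : eLpNorm f 2 μ ^ 2 = ∫⁻ x, ‖f x‖ₑ ^ 2 ∂μ := by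
  have h := eLpNorm_nnreal_pow_eq_lintegral (f := f) (μ := μ) (p := 2) (by norm_num)
  norm_num at h
  exact h

theorem memLp_two_of_lintegral {α E : Type*} [MeasurableSpace α] {μ : Measure α}
    [NormedAddCommGroup E] {f : α → E} (hf : AEStronglyMeasurable f μ)
    (h : ∫⁻ x, ‖f x‖ₑ ^ 2 ∂μ ≠ ⊤) : MemLp f 2 μ := by
  refine ⟨hf, ?_⟩
  rw [← eLpNorm_two_sq] at h
  exact lt_top_iff_ne_top.2 fun h' => h (by simp [h'])

section GridProcess

variable {Ω ι : Type*} [mΩ : MeasurableSpace Ω] {P : Measure Ω} {T : ℝ≥0}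
  {ℱ : Filtration ℝ≥0 mΩ} {γ : ℝ≥0 → Ω → Ell2 ι}

theorem lintegral_gridAverage_ne_top (hγ : IsStronglyProgressive ℱ γ)
    (h2 : ∫⁻ ω, ∫⁻ s in Set.Icc (0 : ℝ) T, ‖γ s.toNNReal ω‖ₑ ^ 2 ∂volume ∂P ≠ ⊤) (n k : ℕ) :
    ∫⁻ ω, ‖gridAverage T n (fun s => γ s.toNNReal ω) k‖ₑ ^ 2 ∂P ≠ ⊤ := by
  refine ne_top_of_le_ne_top (ENNReal.mul_ne_top (ENNReal.ofReal_ne_top (r := (n : ℝ) + 1)) h2) ?_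
  rw [← lintegral_const_mul' _ _ ENNReal.ofReal_ne_top]
  refine lintegral_mono fun ω => ?_
  have hf := aestronglyMeasurable_path (m := ℱ T) (hγ T) ω
  refine (gridAverage_enorm_sq_le T n hf k).trans ?_
  gcongr
  exact fun x hx => ⟨(NNReal.coe_nonneg _).trans hx.1.le, hx.2.trans (gridTime_le T n k)⟩

theorem stronglyMeasurable_gridAverage (hγ : IsStronglyProgressive ℱ γ) (n k : ℕ) :
    StronglyMeasurable[ℱ (gridTime T n k)]
      (fun ω => gridAverage T n (fun s => γ s.toNNReal ω) k) :=
  StronglyMeasurable.const_smul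
    (stronglyMeasurable_integral_progressive (m := ℱ (gridTime T n k)) (hγ (gridTime T n k)) le_rfl)
    ((n : ℝ) + 1)

/-- The simple process which on each interval of the subdivision with mesh `1 / (n + 1)` takes the
average of `γ` over the preceding interval, truncated to the coordinates in `S`. -/
def gridProcess (hγ : IsStronglyProgressive ℱ γ)
    (h2 : ∫⁻ ω, ∫⁻ s in Set.Icc (0 : ℝ) T, ‖γ s.toNNReal ω‖ₑ ^ 2 ∂volume ∂P ≠ ⊤)
    (S : Finset ι) (n : ℕ) : SimpleProcess ι P ℱ T where
  num := ⌈T⌉₊ * (n + 1)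
  time := gridTime T n
  mono := gridTime_mono T n
  le_horizon := gridTime_le T n
  support := S
  coeff k ω := Ell2.truncate S (gridAverage T n (fun s => γ s.toNNReal ω) k)
  adapted k := (Ell2.continuous_truncate S).comp_stronglyMeasurable
    (stronglyMeasurable_gridAverage hγ n k)
  memLp k := by
    have hm := ((stronglyMeasurable_gridAverage (T := T) hγ n k).mono
      (ℱ.le _)).aestronglyMeasurable (μ := P)
    refine (memLp_two_of_lintegral hm (lintegral_gridAverage_ne_top hγ h2 n k)).mono
      ((Ell2.continuous_truncate S).comp_aestronglyMeasurable hm)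
      (ae_of_all _ fun ω => Ell2.norm_truncate_le S _)
  coeff_eq_zero k ω i hi := Ell2.truncate_apply_of_notMem hi _

theorem gridProcess_value (hγ : IsStronglyProgressive ℱ γ)
    (h2 : ∫⁻ ω, ∫⁻ s in Set.Icc (0 : ℝ) T, ‖γ s.toNNReal ω‖ₑ ^ 2 ∂volume ∂P ≠ ⊤)
    (S : Finset ι) (n : ℕ) {s : ℝ} (hs : 0 < s) (hsT : s ≤ T) (ω : Ω) :
    (gridProcess hγ h2 S n).value s.toNNReal ω =
      Ell2.truncate S (gridAverage T n (fun s => γ s.toNNReal ω) (gridIndex n s)) := by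
  have hmem := mem_Ioc_gridTime (n := n) hs hsT
  rw [SimpleProcess.value_toNNReal, Finset.sum_eq_single (gridIndex n s)]
  · exact Set.indicator_of_mem hmem _
  · intro k _ hk
    refine Set.indicator_of_notMem (fun hks => ?_) _
    have hks' : s ∈ Set.Ioc (gridTime T n k : ℝ) (gridTime T n (k + 1)) := hks
    rcases lt_or_gt_of_ne hk with h | h
    · have : (gridTime T n (k + 1) : ℝ) ≤ gridTime T n (gridIndex n s) :=
        gridTime_mono T n h
      linarith [hks'.2, hmem.1]
    · have : (gridTime T n (gridIndex n s + 1) : ℝ) ≤ gridTime T n k :=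
        gridTime_mono T n h
      linarith [hks'.1, hmem.2]
  · intro h
    refine absurd (Finset.mem_range.2 ?_) h
    have hp : 0 < ⌈s * ((n : ℝ) + 1)⌉₊ := Nat.ceil_pos.2 (by positivity)
    have hle : ⌈s * ((n : ℝ) + 1)⌉₊ ≤ ⌈T⌉₊ * (n + 1) := by
      refine Nat.ceil_le.2 ?_
      push_cast
      have : (T : ℝ) ≤ ⌈T⌉₊ := by exact_mod_cast Nat.le_ceil T
      gcongr
      exact hsT.trans this
    change gridIndex n s < ⌈T⌉₊ * (n + 1)
    unfold gridIndex
    omega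

theorem SimpleProcess.lintegral_value (H : SimpleProcess ι P ℱ T) (ω : Ω) :
    ∫⁻ s in Set.Icc (0 : ℝ) T, ‖H.value s.toNNReal ω‖ₑ ^ 2 =
      ENNReal.ofReal (H.bracket H ω) := by
  rw [← integral_inner_value, ofReal_integral_eq_lintegral_ofReal (H.integrable_inner_value H ω)]
  · refine lintegral_congr fun s => ?_
    rw [real_inner_self_eq_norm_sq, ENNReal.ofReal_pow (norm_nonneg _), ofReal_norm]
  · exact ae_of_all _ fun s => real_inner_self_nonneg

/-- Averaging and truncating do not increase the energy of a path. -/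
theorem gridProcess_energy_le (hγ : IsStronglyProgressive ℱ γ)
    (h2 : ∫⁻ ω, ∫⁻ s in Set.Icc (0 : ℝ) T, ‖γ s.toNNReal ω‖ₑ ^ 2 ∂volume ∂P ≠ ⊤)
    (S : Finset ι) (n : ℕ) (ω : Ω) :
    ENNReal.ofReal ((gridProcess hγ h2 S n).bracket (gridProcess hγ h2 S n) ω) ≤
      ∫⁻ s in Set.Icc (0 : ℝ) T, ‖γ s.toNNReal ω‖ₑ ^ 2 := by
  have hf := aestronglyMeasurable_path (m := ℱ T) (hγ T) ω
  refine le_trans ?_ (sum_gridAverage_le T n hf (⌈T⌉₊ * (n + 1)))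
  have hpos : ∀ k, 0 ≤ (gridTime T n (k + 1) : ℝ) - gridTime T n k := fun k =>
    sub_nonneg.2 (NNReal.coe_le_coe.2 (gridTime_mono T n k.le_succ))
  have e : (gridProcess hγ h2 S n).bracket (gridProcess hγ h2 S n) ω =
      ∑ k ∈ Finset.range (⌈T⌉₊ * (n + 1)), ((gridTime T n (k + 1) : ℝ) - gridTime T n k) *
        ‖Ell2.truncate S (gridAverage T n (fun s => γ s.toNNReal ω) k)‖ ^ 2 :=
    SimpleProcess.bracket_self _ ω
  rw [e, ENNReal.ofReal_sum_of_nonneg fun k _ => mul_nonneg (hpos k) (sq_nonneg _)]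
  refine Finset.sum_le_sum fun k _ => ?_
  rw [ENNReal.ofReal_mul (hpos k), ENNReal.ofReal_pow (norm_nonneg _)]
  gcongr
  rw [← ofReal_norm]
  exact ENNReal.ofReal_le_ofReal (Ell2.norm_truncate_le S _)

/-- The paths of the approximating simple processes converge in `L²([0, T])`. -/
theorem gridProcess_tendsto_path (hγ : IsStronglyProgressive ℱ γ)
    (h2 : ∫⁻ ω, ∫⁻ s in Set.Icc (0 : ℝ) T, ‖γ s.toNNReal ω‖ₑ ^ 2 ∂volume ∂P ≠ ⊤)
    {S : ℕ → Finset ι} (hS : Tendsto S atTop atTop) {ω : Ω}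
    (hω : ∫⁻ s in Set.Icc (0 : ℝ) T, ‖γ s.toNNReal ω‖ₑ ^ 2 ≠ ⊤) :
    Tendsto (fun n => ∫⁻ s in Set.Icc (0 : ℝ) T,
      ‖(gridProcess hγ h2 (S n) n).value s.toNNReal ω - γ s.toNNReal ω‖ₑ ^ 2) atTop (𝓝 0) := by
  have hf := aestronglyMeasurable_path (m := ℱ T) (hγ T) ω
  refine tendsto_lintegral_enorm_sub_sq
    (fun n => ((gridProcess hγ h2 (S n) n).value_measurable ω).aestronglyMeasurable) hf hω
    (fun n => ?_) ?_
  · rw [SimpleProcess.lintegral_value]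
    exact gridProcess_energy_le hγ h2 (S n) n ω
  · have hint : IntegrableOn (fun s : ℝ => γ s.toNNReal ω) (Set.Icc (0 : ℝ) T) :=
      (memLp_two_of_lintegral hf hω).integrable one_le_two
    have h0 : ∀ᵐ s ∂(volume.restrict (Set.Icc (0 : ℝ) T)), s ≠ 0 :=
      ae_restrict_of_ae (by simp [ae_iff])
    filter_upwards [ae_tendsto_gridAverage T hint, h0, ae_restrict_mem measurableSet_Icc]
      with s hs hs0 hsI
    have hpos : 0 < s := lt_of_le_of_ne hsI.1 hs0.symm
    simp only [gridProcess_value hγ h2 _ _ hpos hsI.2]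
    exact Ell2.tendsto_truncate_of_tendsto hS hs

theorem measurable_lintegral_value_sub (hγ : IsStronglyProgressive ℱ γ)
    (H : SimpleProcess ι P ℱ T) :
    Measurable fun ω => ∫⁻ s in Set.Icc (0 : ℝ) T,
      ‖H.value s.toNNReal ω - γ s.toNNReal ω‖ₑ ^ 2 := by
  have hm : StronglyMeasurable fun p : Ω × ℝ => γ (min p.2.toNNReal T) p.1 := by
    refine stronglyMeasurable_stopped ((hγ T).mono ?_)
    exact sup_le_sup le_rfl (MeasurableSpace.comap_mono (ℱ.le T))
  have h1 := ((H.value_measurable_uncurry.sub hm).enorm.pow_const 2).lintegral_prod_right'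
    (ν := volume.restrict (Set.Icc (0 : ℝ) T))
  convert! h1 using 2 with ω
  refine setLIntegral_congr_fun measurableSet_Icc fun s hs => ?_
  simp only [Pi.sub_apply]
  rw [min_toNNReal_of_mem_Icc hs]

theorem measurable_lintegral_path (hγ : IsStronglyProgressive ℱ γ) :
    Measurable fun ω => ∫⁻ s in Set.Icc (0 : ℝ) T, ‖γ s.toNNReal ω‖ₑ ^ 2 := by
  have hm : StronglyMeasurable fun p : Ω × ℝ => γ (min p.2.toNNReal T) p.1 := by
    refine stronglyMeasurable_stopped ((hγ T).mono ?_)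
    exact sup_le_sup le_rfl (MeasurableSpace.comap_mono (ℱ.le T))
  have h1 := (hm.enorm.pow_const 2).lintegral_prod_right'
    (ν := volume.restrict (Set.Icc (0 : ℝ) T))
  convert! h1 using 2 with ω
  refine setLIntegral_congr_fun measurableSet_Icc fun s hs => ?_
  simp only
  rw [min_toNNReal_of_mem_Icc hs]

/-- The approximating simple processes converge in `L²([0, T] × Ω)`. -/
theorem gridProcess_tendsto (hγ : IsStronglyProgressive ℱ γ)
    (h2 : ∫⁻ ω, ∫⁻ s in Set.Icc (0 : ℝ) T, ‖γ s.toNNReal ω‖ₑ ^ 2 ∂volume ∂P ≠ ⊤)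
    {S : ℕ → Finset ι} (hS : Tendsto S atTop atTop) :
    Tendsto (fun n => ∫⁻ ω, ∫⁻ s in Set.Icc (0 : ℝ) T,
      ‖(gridProcess hγ h2 (S n) n).value s.toNNReal ω - γ s.toNNReal ω‖ₑ ^ 2 ∂volume ∂P)
      atTop (𝓝 0) := by
  have hfin := ae_lt_top (measurable_lintegral_path hγ) h2
  have hb : ∀ n ω, ∫⁻ s in Set.Icc (0 : ℝ) T,
      ‖(gridProcess hγ h2 (S n) n).value s.toNNReal ω - γ s.toNNReal ω‖ₑ ^ 2 ≤
      4 * ∫⁻ s in Set.Icc (0 : ℝ) T, ‖γ s.toNNReal ω‖ₑ ^ 2 := by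
    intro n ω
    have hm := (((gridProcess hγ h2 (S n) n).value_measurable ω).enorm.pow_const 2).const_mul 2
    calc _ ≤ ∫⁻ s in Set.Icc (0 : ℝ) T,
          (2 * ‖(gridProcess hγ h2 (S n) n).value s.toNNReal ω‖ₑ ^ 2 +
            2 * ‖γ s.toNNReal ω‖ₑ ^ 2) := lintegral_mono fun s => enorm_sub_sq_le _ _
      _ = 2 * ENNReal.ofReal ((gridProcess hγ h2 (S n) n).bracket
            (gridProcess hγ h2 (S n) n) ω) +
            2 * ∫⁻ s in Set.Icc (0 : ℝ) T, ‖γ s.toNNReal ω‖ₑ ^ 2 := by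
          rw [lintegral_add_left hm, lintegral_const_mul' _ _ (by norm_num),
            lintegral_const_mul' _ _ (by norm_num), SimpleProcess.lintegral_value]
      _ ≤ 2 * (∫⁻ s in Set.Icc (0 : ℝ) T, ‖γ s.toNNReal ω‖ₑ ^ 2) +
            2 * ∫⁻ s in Set.Icc (0 : ℝ) T, ‖γ s.toNNReal ω‖ₑ ^ 2 := by
          gcongr
          exact gridProcess_energy_le hγ h2 (S n) n ω
      _ = _ := by rw [← add_mul]; norm_num
  have := tendsto_lintegral_of_dominated_convergence (μ := P)
    (fun ω => 4 * ∫⁻ s in Set.Icc (0 : ℝ) T, ‖γ s.toNNReal ω‖ₑ ^ 2)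
    (fun n => measurable_lintegral_value_sub hγ (gridProcess hγ h2 (S n) n))
    (fun n => ae_of_all _ (hb n))
    (by
      rw [lintegral_const_mul' _ _ (by norm_num)]
      exact ENNReal.mul_ne_top (by norm_num) h2)
    (hfin.mono fun ω hω => gridProcess_tendsto_path hγ h2 hS hω.ne)
  simpa using this

end GridProcess

/-! ### Limits of exponential martingales -/

section ExponentialLimit

variable {Ω : Type*} [MeasurableSpace Ω] {P : Measure Ω}

/-- Random variables `I n` and `b n`, to be thought of as stochastic integrals and their quadratic
variations, whose exponentials have mean one and which converge almost surely to `M` and `e`; the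
quadratic variations are dominated by the limit `e`, which has exponential moments of all orders. -/
structure ExponentialApproximation (P : Measure Ω) (I b : ℕ → Ω → ℝ) (M e : Ω → ℝ) : Prop where
  measurable_I : ∀ n, AEMeasurable (I n) P
  measurable_b : ∀ n, AEMeasurable (b n) P
  measurable_M : AEMeasurable M P
  measurable_e : AEMeasurable e P
  nonneg_b : ∀ n ω, 0 ≤ b n ω
  nonneg_e : ∀ ω, 0 ≤ e ω
  lintegral_exp : ∀ n (q : ℝ),
    ∫⁻ ω, ENNReal.ofReal (Real.exp (q * I n ω - q ^ 2 / 2 * b n ω)) ∂P = 1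
  b_le : ∀ n, ∀ᵐ ω ∂P, b n ω ≤ e ω
  tendsto_I : ∀ᵐ ω ∂P, Tendsto (fun n => I n ω) atTop (𝓝 (M ω))
  tendsto_b : ∀ᵐ ω ∂P, Tendsto (fun n => b n ω) atTop (𝓝 (e ω))
  integrable_exp : ∀ a : ℝ, 0 ≤ a → Integrable (fun ω => Real.exp (a * e ω)) P

theorem mul_le_sq_add_sq (x y : ℝ) : x * y ≤ x ^ 2 + y ^ 2 := by
  nlinarith [sq_nonneg (x - y), sq_nonneg x, sq_nonneg y]

namespace ExponentialApproximation

variable {I b : ℕ → Ω → ℝ} {M e : Ω → ℝ}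

/-- A bound for `E[exp (q I n)]` which does not depend on `n`: the random variable is the product of
`exp (q I n - q² b n)`, whose square has mean one, and of `exp (q² b n) ≤ exp (q² e)`. -/
theorem lintegral_exp_le (h : ExponentialApproximation P I b M e) (q : ℝ) (n : ℕ) :
    ∫⁻ ω, ENNReal.ofReal (Real.exp (q * I n ω)) ∂P ≤
      1 + ∫⁻ ω, ENNReal.ofReal (Real.exp (2 * q ^ 2 * e ω)) ∂P := by
  rw [← h.lintegral_exp n (2 * q), ← lintegral_add_left']
  · refine lintegral_mono_ae ?_
    filter_upwards [h.b_le n] with ω hω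
    rw [← ENNReal.ofReal_add (Real.exp_pos _).le (Real.exp_pos _).le]
    refine ENNReal.ofReal_le_ofReal ?_
    have h1 := mul_le_sq_add_sq (Real.exp (q * I n ω - q ^ 2 * b n ω)) (Real.exp (q ^ 2 * b n ω))
    rw [← Real.exp_add, ← Real.exp_nat_mul, ← Real.exp_nat_mul] at h1
    have h2 : Real.exp ((2 : ℕ) * (q ^ 2 * b n ω)) ≤ Real.exp (2 * q ^ 2 * e ω) := by
      refine Real.exp_le_exp.2 ?_
      push_cast
      nlinarith [mul_le_mul_of_nonneg_left hω (sq_nonneg q)]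
    refine le_trans (le_of_eq ?_) (h1.trans (add_le_add (le_of_eq ?_) h2)) <;>
    · congr 1
      push_cast
      ring
  · have := h.measurable_I n
    have := h.measurable_b n
    fun_prop

theorem lintegral_exp_limit_le (h : ExponentialApproximation P I b M e) (q : ℝ) :
    ∫⁻ ω, ENNReal.ofReal (Real.exp (q * M ω)) ∂P ≤
      1 + ∫⁻ ω, ENNReal.ofReal (Real.exp (2 * q ^ 2 * e ω)) ∂P := by
  have hlim : ∀ᵐ ω ∂P, liminf (fun n => ENNReal.ofReal (Real.exp (q * I n ω))) atTop =
      ENNReal.ofReal (Real.exp (q * M ω)) := by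
    filter_upwards [h.tendsto_I] with ω hω
    exact (ENNReal.tendsto_ofReal ((hω.const_mul q).rexp)).liminf_eq
  rw [← lintegral_congr_ae hlim]
  refine (lintegral_liminf_le' fun n => ?_).trans ?_
  · have := h.measurable_I n
    fun_prop
  · exact liminf_le_of_le (by isBoundedDefault) fun c hc => by
      obtain ⟨n, hn⟩ := hc.exists
      exact hn.trans (h.lintegral_exp_le q n)

theorem bound_ne_top (h : ExponentialApproximation P I b M e) (q : ℝ) :
    1 + ∫⁻ ω, ENNReal.ofReal (Real.exp (2 * q ^ 2 * e ω)) ∂P ≠ ⊤ := by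
  refine ENNReal.add_ne_top.2 ⟨by norm_num, ?_⟩
  rw [← ofReal_integral_eq_lintegral_ofReal (h.integrable_exp _ (by positivity))
    (ae_of_all _ fun ω => (Real.exp_pos _).le)]
  exact ENNReal.ofReal_ne_top

theorem integrable_exp_limit (h : ExponentialApproximation P I b M e) (q : ℝ) :
    Integrable (fun ω => Real.exp (q * M ω)) P := by
  have := h.measurable_M
  refine ⟨AEMeasurable.aestronglyMeasurable (by fun_prop), ?_⟩
  rw [hasFiniteIntegral_iff_ofReal (ae_of_all _ fun ω => (Real.exp_pos _).le)]
  exact lt_of_le_of_lt (h.lintegral_exp_limit_le q) (lt_top_iff_ne_top.2 (h.bound_ne_top q))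

/-- The limiting density has moments of all orders, positive and negative. -/
theorem integrable_rpow (h : ExponentialApproximation P I b M e) (p : ℝ) :
    Integrable (fun ω => Real.exp (-(1 / 2) * e ω - M ω) ^ p) P := by
  have hM := h.measurable_M
  have he := h.measurable_e
  refine ((h.integrable_exp |p| (abs_nonneg p)).add (h.integrable_exp_limit (-(2 * p)))).mono'
    (AEMeasurable.aestronglyMeasurable (by fun_prop)) (ae_of_all _ fun ω => ?_)
  rw [Real.norm_of_nonneg (by positivity), ← Real.exp_mul]
  have h1 := mul_le_sq_add_sq (Real.exp (-(p / 2) * e ω)) (Real.exp (-p * M ω))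
  rw [← Real.exp_add, ← Real.exp_nat_mul, ← Real.exp_nat_mul] at h1
  have h2 : Real.exp ((2 : ℕ) * (-(p / 2) * e ω)) ≤ Real.exp (|p| * e ω) := by
    refine Real.exp_le_exp.2 ?_
    push_cast
    nlinarith [mul_le_mul_of_nonneg_right (neg_abs_le p) (h.nonneg_e ω), h.nonneg_e ω]
  refine le_trans (le_of_eq ?_) (h1.trans (add_le_add h2 (le_of_eq ?_))) <;>
  · congr 1
    push_cast
    ring

theorem tendsto_density (h : ExponentialApproximation P I b M e) :
    ∀ᵐ ω ∂P, Tendsto (fun n => Real.exp (-1 * I n ω - (-1) ^ 2 / 2 * b n ω)) atTop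
      (𝓝 (Real.exp (-(1 / 2) * e ω - M ω))) := by
  filter_upwards [h.tendsto_I, h.tendsto_b] with ω h1 h2
  have := ((h1.const_mul (-1)).sub (h2.const_mul ((-1) ^ 2 / 2))).rexp
  convert this using 2
  ring_nf

/-- The limiting density has mean one. The lower bound holds because the approximating densities
are bounded in `L²`, hence uniformly integrable: `x ≤ min x K + x² / K`. -/
theorem lintegral_density [IsProbabilityMeasure P] (h : ExponentialApproximation P I b M e) :
    ∫⁻ ω, ENNReal.ofReal (Real.exp (-(1 / 2) * e ω - M ω)) ∂P = 1 := by
  set Z : ℕ → Ω → ℝ := fun n ω => Real.exp (-1 * I n ω - (-1) ^ 2 / 2 * b n ω) with hZ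
  set ξ : Ω → ℝ := fun ω => Real.exp (-(1 / 2) * e ω - M ω) with hξ
  have hZm : ∀ n, AEMeasurable (Z n) P := fun n => by
    have := h.measurable_I n
    have := h.measurable_b n
    fun_prop
  have hZlim : ∀ᵐ ω ∂P, Tendsto (fun n => Z n ω) atTop (𝓝 (ξ ω)) := h.tendsto_density
  refine le_antisymm ?_ ?_
  · have hlim : ∀ᵐ ω ∂P, liminf (fun n => ENNReal.ofReal (Z n ω)) atTop =
        ENNReal.ofReal (ξ ω) := by
      filter_upwards [hZlim] with ω hω
      exact (ENNReal.tendsto_ofReal hω).liminf_eq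
    rw [← lintegral_congr_ae hlim]
    refine (lintegral_liminf_le' fun n => (hZm n).ennreal_ofReal).trans ?_
    simp only [hZ, h.lintegral_exp, liminf_const, le_refl]
  · set C := 1 + ∫⁻ ω, ENNReal.ofReal (Real.exp (2 * (-2) ^ 2 * e ω)) ∂P with hC
    have hCt : C ≠ ⊤ := h.bound_ne_top (-2)
    have key : ∀ k : ℕ, 1 ≤ ∫⁻ ω, ENNReal.ofReal (ξ ω) ∂P + C / (k + 1 : ℕ) := by
      intro k
      have hk : (0 : ℝ) < ((k + 1 : ℕ) : ℝ) := by positivity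
      have h1 : ∀ n, 1 ≤ ∫⁻ ω, ENNReal.ofReal (min (Z n ω) (k + 1 : ℕ)) ∂P + C / (k + 1 : ℕ) := by
        intro n
        have hI := h.measurable_I n
        calc (1 : ℝ≥0∞) = ∫⁻ ω, ENNReal.ofReal (Z n ω) ∂P := (h.lintegral_exp n (-1)).symm
          _ ≤ ∫⁻ ω, (ENNReal.ofReal (min (Z n ω) (k + 1 : ℕ)) +
                ENNReal.ofReal (Real.exp (-2 * I n ω)) / (k + 1 : ℕ)) ∂P := by
              refine lintegral_mono fun ω => ?_
              have hsq : Z n ω ^ 2 ≤ Real.exp (-2 * I n ω) := by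
                rw [hZ, ← Real.exp_nat_mul]
                refine Real.exp_le_exp.2 ?_
                push_cast
                linarith [h.nonneg_b n ω]
              have hle : Z n ω ≤ min (Z n ω) (k + 1 : ℕ) +
                  Real.exp (-2 * I n ω) / (k + 1 : ℕ) := by
                rcases le_total (Z n ω) ((k + 1 : ℕ) : ℝ) with hc | hc
                · rw [min_eq_left hc]
                  have : 0 ≤ Real.exp (-2 * I n ω) / (k + 1 : ℕ) := by positivity
                  linarith
                · rw [min_eq_right hc]
                  have : Z n ω ≤ Real.exp (-2 * I n ω) / (k + 1 : ℕ) := by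
                    rw [le_div_iff₀ hk]
                    have : 0 < Z n ω := Real.exp_pos _
                    nlinarith
                  linarith
              refine (ENNReal.ofReal_le_ofReal hle).trans ?_
              rw [ENNReal.ofReal_add (le_min (Real.exp_pos _).le hk.le) (by positivity),
                ENNReal.ofReal_div_of_pos hk, ENNReal.ofReal_natCast]
          _ = ∫⁻ ω, ENNReal.ofReal (min (Z n ω) (k + 1 : ℕ)) ∂P +
                (∫⁻ ω, ENNReal.ofReal (Real.exp (-2 * I n ω)) ∂P) / (k + 1 : ℕ) := by
              rw [lintegral_add_left' ((hZm n).min aemeasurable_const).ennreal_ofReal]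
              simp only [div_eq_mul_inv]
              rw [lintegral_mul_const'' _ (by fun_prop)]
          _ ≤ _ := by
              gcongr
              exact h.lintegral_exp_le (-2) n
      have h2 : Tendsto (fun n => ∫⁻ ω, ENNReal.ofReal (min (Z n ω) (k + 1 : ℕ)) ∂P) atTop
          (𝓝 (∫⁻ ω, ENNReal.ofReal (min (ξ ω) (k + 1 : ℕ)) ∂P)) := by
        refine tendsto_lintegral_of_dominated_convergence' (fun _ => ((k + 1 : ℕ) : ℝ≥0∞))
          (fun n => ((hZm n).min aemeasurable_const).ennreal_ofReal)
          (fun n => ae_of_all _ fun ω => ?_) (by simp) ?_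
        · refine (ENNReal.ofReal_le_ofReal (min_le_right _ _)).trans ?_
          rw [ENNReal.ofReal_natCast]
        · filter_upwards [hZlim] with ω hω
          exact ENNReal.tendsto_ofReal (hω.min tendsto_const_nhds)
      refine (ge_of_tendsto' (h2.add_const (C / (k + 1 : ℕ))) h1).trans ?_
      gcongr
      exact min_le_left _ _
    have h3 : Tendsto (fun k : ℕ => ∫⁻ ω, ENNReal.ofReal (ξ ω) ∂P + C / (k + 1 : ℕ)) atTop
        (𝓝 (∫⁻ ω, ENNReal.ofReal (ξ ω) ∂P + 0)) := by
      refine Tendsto.const_add _ ?_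
      have := ENNReal.Tendsto.const_div ((tendsto_add_atTop_iff_nat 1).2
        ENNReal.tendsto_nat_nhds_top) (Or.inr hCt)
      simpa using this
    rw [add_zero] at h3
    exact ge_of_tendsto' h3 key

theorem integral_density [IsProbabilityMeasure P] (h : ExponentialApproximation P I b M e) :
    ∫ ω, Real.exp (-(1 / 2) * e ω - M ω) ∂P = 1 := by
  have hi : Integrable (fun ω => Real.exp (-(1 / 2) * e ω - M ω)) P := by
    simpa using h.integrable_rpow 1
  have := ofReal_integral_eq_lintegral_ofReal hi (ae_of_all _ fun ω => (Real.exp_pos _).le)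
  rw [h.lintegral_density, ENNReal.ofReal_eq_one] at this
  exact this

end ExponentialApproximation

end ExponentialLimit

/-! ### Existence of the Itô integral and moments of the Girsanov density -/

section Ito

theorem tendsto_eLpNorm_two_iff {α E β : Type*} [MeasurableSpace α] {μ : Measure α}
    [NormedAddCommGroup E] {f : β → α → E} {l : Filter β} :
    Tendsto (fun n => eLpNorm (f n) 2 μ) l (𝓝 0) ↔
      Tendsto (fun n => ∫⁻ x, ‖f n x‖ₑ ^ 2 ∂μ) l (𝓝 0) := by
  simp only [← eLpNorm_two_sq]
  refine ⟨fun h => by simpa using ENNReal.Tendsto.pow (n := 2) h, fun h => ?_⟩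
  have h1 := h.ennrpow_const (1 / 2)
  rw [ENNReal.zero_rpow_of_pos (by norm_num)] at h1
  refine h1.congr fun n => ?_
  rw [← ENNReal.rpow_natCast, ← ENNReal.rpow_mul]
  norm_num

/-- The almost everywhere limit of a sequence of functions that are measurable for a smaller
`σ`-algebra is almost everywhere equal to such a function. -/
theorem aestronglyMeasurable_of_tendsto_ae_of_stronglyMeasurable {α : Type*}
    {m m0 : MeasurableSpace α} {μ : Measure α} {u : ℕ → α → ℝ} {g : α → ℝ}
    (hu : ∀ n, StronglyMeasurable[m] (u n))
    (h : ∀ᵐ x ∂μ, Tendsto (fun n => u n x) atTop (𝓝 (g x))) : AEStronglyMeasurable[m] g μ := by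
  refine ⟨fun x => limUnder atTop fun n => u n x,
    by let := m; exact StronglyMeasurable.limUnder hu, ?_⟩
  filter_upwards [h] with x hx using hx.limUnder_eq.symm

variable {Ω ι : Type*} {T : ℝ≥0} {γ : ℝ≥0 → Ω → Ell2 ι}

theorem lintegral_path_eq_energy {ω : Ω}
    (hω : IntegrableOn (fun s : ℝ => ‖γ s.toNNReal ω‖ ^ 2) (Set.Icc 0 T)) :
    ∫⁻ s in Set.Icc (0 : ℝ) T, ‖γ s.toNNReal ω‖ₑ ^ 2 = ENNReal.ofReal (energy T γ ω) := by
  rw [energy, ofReal_integral_eq_lintegral_ofReal hω (ae_of_all _ fun s => by positivity)]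
  exact lintegral_congr fun s => by rw [ENNReal.ofReal_pow (norm_nonneg _), ofReal_norm]

theorem energy_nonneg (ω : Ω) : 0 ≤ energy T γ ω := integral_nonneg fun s => by positivity

variable [mΩ : MeasurableSpace Ω] {P : Measure Ω}
  {W : ι → ℝ≥0 → Ω → ℝ} {hWm : ∀ i t, Measurable (W i t)}

theorem lintegral_value_sub_le {ℱ : Filtration ℝ≥0 mΩ} (hγ : IsStronglyProgressive ℱ γ)
    (H H' : SimpleProcess ι P ℱ T) :
    ∫⁻ ω, ∫⁻ s in Set.Icc (0 : ℝ) T,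
        ‖H.value s.toNNReal ω - H'.value s.toNNReal ω‖ₑ ^ 2 ∂volume ∂P ≤
      2 * (∫⁻ ω, ∫⁻ s in Set.Icc (0 : ℝ) T,
        ‖H.value s.toNNReal ω - γ s.toNNReal ω‖ₑ ^ 2 ∂volume ∂P) +
      2 * ∫⁻ ω, ∫⁻ s in Set.Icc (0 : ℝ) T,
        ‖H'.value s.toNNReal ω - γ s.toNNReal ω‖ₑ ^ 2 ∂volume ∂P := by
  have m := measurable_lintegral_value_sub (P := P) (T := T) hγ H
  rw [← lintegral_const_mul' _ _ (by norm_num), ← lintegral_const_mul' _ _ (by norm_num),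
    ← lintegral_add_left (m.const_mul 2)]
  refine lintegral_mono fun ω => ?_
  have hf := aestronglyMeasurable_path (m := ℱ T) (hγ T) ω
  have hm : AEMeasurable (fun s : ℝ => 2 * ‖H.value s.toNNReal ω - γ s.toNNReal ω‖ₑ ^ 2)
      (volume.restrict (Set.Icc (0 : ℝ) T)) :=
    (((H.value_measurable ω).aestronglyMeasurable.sub hf).enorm.pow_const 2).const_mul 2
  simp only
  rw [← lintegral_const_mul' _ _ (by norm_num), ← lintegral_const_mul' _ _ (by norm_num),
    ← lintegral_add_left' hm]
  refine lintegral_mono fun s => ?_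
  have := enorm_sub_sq_le (H.value s.toNNReal ω - γ s.toNNReal ω)
    (H'.value s.toNNReal ω - γ s.toNNReal ω)
  rwa [sub_sub_sub_cancel_right] at this

theorem HasExpMoments.lintegral_ne_top (h : HasExpMoments P T γ) :
    ∫⁻ ω, ∫⁻ s in Set.Icc (0 : ℝ) T, ‖γ s.toNNReal ω‖ₑ ^ 2 ∂volume ∂P ≠ ⊤ := by
  have h1 := h.2 1 zero_le_one
  have h2 : ∫⁻ ω, ENNReal.ofReal (Real.exp (1 * energy T γ ω)) ∂P ≠ ⊤ := by
    rw [← ofReal_integral_eq_lintegral_ofReal h1 (ae_of_all _ fun ω => (Real.exp_pos _).le)]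
    exact ENNReal.ofReal_ne_top
  refine ne_top_of_le_ne_top h2 (lintegral_mono_ae ?_)
  filter_upwards [h.1] with ω hω
  rw [lintegral_path_eq_energy hω, one_mul]
  exact ENNReal.ofReal_le_ofReal ((le_add_of_nonneg_right zero_le_one).trans
    (Real.add_one_le_exp _))

theorem SimpleProcess.bracket_self_nonneg {ℱ : Filtration ℝ≥0 mΩ} (H : SimpleProcess ι P ℱ T)
    (ω : Ω) : 0 ≤ H.bracket H ω := by
  rw [← energy_value]
  exact integral_nonneg fun s => by positivity

/-- Convergence of a path in `L²([0, T])` implies convergence of its energy. -/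
theorem tendsto_bracket_of_tendsto_path {ℱ : Filtration ℝ≥0 mΩ} (hγ : IsStronglyProgressive ℱ γ)
    {H : ℕ → SimpleProcess ι P ℱ T} {ω : Ω}
    (hω : IntegrableOn (fun s : ℝ => ‖γ s.toNNReal ω‖ ^ 2) (Set.Icc 0 T))
    (hle : ∀ n, (H n).bracket (H n) ω ≤ energy T γ ω)
    (h : Tendsto (fun n => ∫⁻ s in Set.Icc (0 : ℝ) T,
      ‖(H n).value s.toNNReal ω - γ s.toNNReal ω‖ₑ ^ 2) atTop (𝓝 0)) :
    Tendsto (fun n => (H n).bracket (H n) ω) atTop (𝓝 (energy T γ ω)) := by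
  set μ := volume.restrict (Set.Icc (0 : ℝ) T)
  set f : ℝ → Ell2 ι := fun s => γ s.toNNReal ω
  set g : ℕ → ℝ → Ell2 ι := fun n s => (H n).value s.toNNReal ω
  have hf : AEStronglyMeasurable f μ := aestronglyMeasurable_path (m := ℱ T) (hγ T) ω
  have hg : ∀ n, AEStronglyMeasurable (g n) μ := fun n =>
    ((H n).value_measurable ω).aestronglyMeasurable
  have hsq : eLpNorm f 2 μ ^ 2 = ENNReal.ofReal (energy T γ ω) :=
    (eLpNorm_two_sq f).trans (lintegral_path_eq_energy hω)
  have hsqn : ∀ n, eLpNorm (g n) 2 μ ^ 2 = ENNReal.ofReal ((H n).bracket (H n) ω) := fun n =>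
    (eLpNorm_two_sq (g n)).trans ((H n).lintegral_value ω)
  have hft : eLpNorm f 2 μ ≠ ⊤ := fun h' => by simp [h'] at hsq
  have hd : Tendsto (fun n => eLpNorm (g n - f) 2 μ) atTop (𝓝 0) := tendsto_eLpNorm_two_iff.2 h
  have hlim : Tendsto (fun n => eLpNorm (g n) 2 μ) atTop (𝓝 (eLpNorm f 2 μ)) := by
    have hlow : Tendsto (fun n => eLpNorm f 2 μ - eLpNorm (g n - f) 2 μ) atTop
        (𝓝 (eLpNorm f 2 μ)) := by
      simpa using ENNReal.Tendsto.sub (tendsto_const_nhds (x := eLpNorm f 2 μ)) hd (Or.inl hft)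
    refine tendsto_of_tendsto_of_tendsto_of_le_of_le hlow tendsto_const_nhds (fun n => ?_)
      fun n => ?_
    · refine tsub_le_iff_right.2 ?_
      have := eLpNorm_sub_le (hg n) ((hg n).sub hf) (p := 2) one_le_two
      rwa [sub_sub_cancel] at this
    · have : eLpNorm (g n) 2 μ ^ 2 ≤ eLpNorm f 2 μ ^ 2 := by
        rw [hsq, hsqn]
        exact ENNReal.ofReal_le_ofReal (hle n)
      exact (ENNReal.pow_le_pow_left_iff two_ne_zero).1 this
  have h2 := ENNReal.Tendsto.pow (n := 2) hlim
  simp only [hsq, hsqn] at h2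
  have h3 := (ENNReal.tendsto_toReal (by simp)).comp h2
  rw [ENNReal.toReal_ofReal (energy_nonneg ω)] at h3
  refine h3.congr fun n => ?_
  exact ENNReal.toReal_ofReal ((H n).bracket_self_nonneg ω)

variable [IsProbabilityMeasure P]

/-- Square integrable progressive processes are Itô integrable: by the isometry the integrals of
approximating simple processes form a Cauchy sequence in `L²`. -/
theorem exists_isItoIntegral [Countable ι] (hW : IsBrownianFamilyOn P T W)
    (hγ : IsStronglyProgressive (generatedFiltration P W hWm) γ)
    (h2 : ∫⁻ ω, ∫⁻ s in Set.Icc (0 : ℝ) T, ‖γ s.toNNReal ω‖ₑ ^ 2 ∂volume ∂P ≠ ⊤) :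
    ∃ M, IsItoIntegral P (generatedFiltration P W hWm) W T γ M := by
  classical
  obtain ⟨S, hS⟩ := exists_seq_tendsto (atTop : Filter (Finset ι))
  set H : ℕ → SimpleProcess ι P (generatedFiltration P W hWm) T :=
    fun n => gridProcess hγ h2 (S n) n with hH
  have hconv := gridProcess_tendsto hγ h2 hS
  have hI : ∀ n, MemLp ((H n).integral W) 2 P := fun n => (H n).memLp_integral hW
  let u : ℕ → Lp ℝ 2 P := fun n => (hI n).toLp
  have hu : CauchySeq u := by
    rw [Lp.cauchySeq_Lp_iff_cauchySeq_eLpNorm, tendsto_eLpNorm_two_iff]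
    have hb : ∀ p : ℕ × ℕ, ∫⁻ ω, ‖(u p.1 - u p.2 : Ω → ℝ) ω‖ₑ ^ 2 ∂P ≤
        2 * (∫⁻ ω, ∫⁻ s in Set.Icc (0 : ℝ) T,
          ‖(H p.1).value s.toNNReal ω - γ s.toNNReal ω‖ₑ ^ 2 ∂volume ∂P) +
        2 * ∫⁻ ω, ∫⁻ s in Set.Icc (0 : ℝ) T,
          ‖(H p.2).value s.toNNReal ω - γ s.toNNReal ω‖ₑ ^ 2 ∂volume ∂P := by
      intro p
      refine le_trans (le_of_eq ?_) (lintegral_value_sub_le hγ (H p.1) (H p.2))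
      rw [← SimpleProcess.lintegral_integral_sub hW]
      refine lintegral_congr_ae ?_
      filter_upwards [(hI p.1).coeFn_toLp, (hI p.2).coeFn_toLp] with ω h1 h2
      simp only [Pi.sub_apply, u, h1, h2]
    refine tendsto_of_tendsto_of_tendsto_of_le_of_le tendsto_const_nhds ?_ (fun _ => zero_le) hb
    have hp : Tendsto (Prod.fst : ℕ × ℕ → ℕ) atTop atTop := by
      rw [← prod_atTop_atTop_eq]; exact tendsto_fst
    have hp' : Tendsto (Prod.snd : ℕ × ℕ → ℕ) atTop atTop := by
      rw [← prod_atTop_atTop_eq]; exact tendsto_snd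
    have t1 := ENNReal.Tendsto.const_mul (a := 2) (hconv.comp hp) (Or.inr (by norm_num))
    have t2 := ENNReal.Tendsto.const_mul (a := 2) (hconv.comp hp') (Or.inr (by norm_num))
    simpa using t1.add t2
  obtain ⟨g, hg⟩ := cauchySeq_tendsto_of_complete hu
  refine ⟨g, Lp.memLp g, H, hconv, ?_⟩
  have h3 := (Lp.tendsto_Lp_iff_tendsto_eLpNorm' u g).1 hg
  refine h3.congr fun n => eLpNorm_congr_ae ?_
  filter_upwards [(hI n).coeFn_toLp] with ω h1
  simp only [Pi.sub_apply, u, h1]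

theorem isItoIntegral_itoIntegral [Countable ι] (hW : IsBrownianFamilyOn P T W)
    (hγ : IsStronglyProgressive (generatedFiltration P W hWm) γ)
    (h2 : ∫⁻ ω, ∫⁻ s in Set.Icc (0 : ℝ) T, ‖γ s.toNNReal ω‖ₑ ^ 2 ∂volume ∂P ≠ ⊤) :
    IsItoIntegral P (generatedFiltration P W hWm) W T γ
      (itoIntegral P (generatedFiltration P W hWm) W T γ) := by
  have h := exists_isItoIntegral hW hγ h2
  rw [itoIntegral, dif_pos h]
  exact h.choose_spec

/-- The integrals of every approximating sequence of simple processes converge to the Itô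
integral. -/
theorem IsItoIntegral.tendsto_of_tendsto (hW : IsBrownianFamilyOn P T W)
    (hγ : IsStronglyProgressive (generatedFiltration P W hWm) γ) {M : Ω → ℝ}
    (hM : IsItoIntegral P (generatedFiltration P W hWm) W T γ M)
    {H : ℕ → SimpleProcess ι P (generatedFiltration P W hWm) T}
    (hH : Tendsto (fun n => ∫⁻ ω, ∫⁻ s in Set.Icc (0 : ℝ) T,
      ‖(H n).value s.toNNReal ω - γ s.toNNReal ω‖ₑ ^ 2 ∂volume ∂P) atTop (𝓝 0)) :
    Tendsto (fun n => eLpNorm ((H n).integral W - M) 2 P) atTop (𝓝 0) := by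
  obtain ⟨hM2, H', hH', hI'⟩ := hM
  have hsub : Tendsto (fun n => eLpNorm ((H n).integral W - (H' n).integral W) 2 P) atTop
      (𝓝 0) := by
    rw [tendsto_eLpNorm_two_iff]
    refine tendsto_of_tendsto_of_tendsto_of_le_of_le tendsto_const_nhds ?_ (fun _ => zero_le)
      fun n => (SimpleProcess.lintegral_integral_sub hW (H n) (H' n)).le.trans
        (lintegral_value_sub_le hγ (H n) (H' n))
    have t1 := ENNReal.Tendsto.const_mul (a := 2) hH (Or.inr (by norm_num))
    have t2 := ENNReal.Tendsto.const_mul (a := 2) hH' (Or.inr (by norm_num))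
    simpa using t1.add t2
  refine tendsto_of_tendsto_of_tendsto_of_le_of_le tendsto_const_nhds
    (by simpa using hsub.add hI') (fun _ => zero_le) fun n => ?_
  have := eLpNorm_add_le (((H n).memLp_integral hW).sub ((H' n).memLp_integral hW)).1
    (((H' n).memLp_integral hW).sub hM2).1 one_le_two
  rwa [sub_add_sub_cancel] at this

theorem exists_exponentialApproximation [Countable ι] (hW : IsBrownianFamilyOn P T W)
    (hγ : IsStronglyProgressive (generatedFiltration P W hWm) γ) (hexp : HasExpMoments P T γ) :
    ∃ H : ℕ → SimpleProcess ι P (generatedFiltration P W hWm) T,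
      ExponentialApproximation P (fun n => (H n).integral W) (fun n => (H n).bracket (H n))
        (itoIntegral P (generatedFiltration P W hWm) W T γ) (energy T γ) := by
  classical
  have h2 := hexp.lintegral_ne_top
  obtain ⟨S, hS⟩ := exists_seq_tendsto (atTop : Filter (Finset ι))
  have hM := isItoIntegral_itoIntegral hW hγ h2
  have hlim := hM.tendsto_of_tendsto hW hγ (gridProcess_tendsto hγ h2 hS)
  obtain ⟨ns, hns, hae⟩ := (tendstoInMeasure_of_tendsto_eLpNorm two_ne_zero
    (fun n => ((gridProcess hγ h2 (S n) n).memLp_integral hW).1) hM.1.1 hlim).exists_seq_tendsto_ae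
  have hle : ∀ n, ∀ᵐ ω ∂P, (gridProcess hγ h2 (S n) n).bracket (gridProcess hγ h2 (S n) n) ω ≤
      energy T γ ω := by
    intro n
    filter_upwards [hexp.1] with ω hω
    have := gridProcess_energy_le hγ h2 (S n) n ω
    rw [lintegral_path_eq_energy hω] at this
    exact (ENNReal.ofReal_le_ofReal_iff (energy_nonneg ω)).1 this
  refine ⟨fun k => gridProcess hγ h2 (S (ns k)) (ns k), ?_⟩
  exact
    { measurable_I := fun n => ((gridProcess hγ h2 _ _).memLp_integral hW).1.aemeasurable
      measurable_b := fun n => ((gridProcess hγ h2 _ _).integrable_bracket _).1.aemeasurable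
      measurable_M := hM.1.1.aemeasurable
      measurable_e := ((stronglyMeasurable_energy (m := generatedFiltration P W hWm T)
        (hγ T)).mono ((generatedFiltration P W hWm).le T)).measurable.aemeasurable
      nonneg_b := fun n ω => SimpleProcess.bracket_self_nonneg _ ω
      nonneg_e := energy_nonneg
      lintegral_exp := fun n q => (gridProcess hγ h2 _ _).lintegral_exp hW q
      b_le := fun n => hle (ns n)
      tendsto_I := hae
      tendsto_b := by
        filter_upwards [ae_all_iff.2 hle, hexp.1] with ω h1 hω
        refine (tendsto_bracket_of_tendsto_path hγ hω h1 (gridProcess_tendsto_path hγ h2 hS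
          ?_)).comp hns.tendsto_atTop
        rw [lintegral_path_eq_energy hω]
        exact ENNReal.ofReal_ne_top
      integrable_exp := hexp.2 }

/-- The properties of the state price density `ξ` on which the optimisation problem depends. -/
structure IsStatePriceDensity {Ω : Type*} (𝒢 : MeasurableSpace Ω) [mΩ : MeasurableSpace Ω]
    (P : Measure Ω) (ξ : Ω → ℝ) : Prop where
  measurable : AEStronglyMeasurable[𝒢] ξ P
  pos : ∀ ω, 0 < ξ ω
  integrable_rpow : ∀ p : ℝ, Integrable (fun ω => ξ ω ^ p) P
  integral_eq_one : ∫ ω, ξ ω ∂P = 1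

theorem isStatePriceDensity_girsanovDensity [Countable ι] (hW : IsBrownianFamilyOn P T W)
    (hγ : IsStronglyProgressive (generatedFiltration P W hWm) γ) (hexp : HasExpMoments P T γ) :
    IsStatePriceDensity (generatedFiltration P W hWm T) P
      (girsanovDensity P (generatedFiltration P W hWm) W T γ) := by
  obtain ⟨H, hH⟩ := exists_exponentialApproximation hW hγ hexp
  refine ⟨?_, fun ω => Real.exp_pos _, hH.integrable_rpow, hH.integral_density⟩
  have hM : AEStronglyMeasurable[generatedFiltration P W hWm T]
      (itoIntegral P (generatedFiltration P W hWm) W T γ) P :=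
    aestronglyMeasurable_of_tendsto_ae_of_stronglyMeasurable
      (fun n => (H n).integral_measurable.stronglyMeasurable) hH.tendsto_I
  have he : AEStronglyMeasurable[generatedFiltration P W hWm T] (energy T γ) P :=
    (stronglyMeasurable_energy (m := generatedFiltration P W hWm T) (hγ T)).aestronglyMeasurable
  exact Real.continuous_exp.comp_aestronglyMeasurable ((he.const_mul _).sub hM)

end Ito

/-! ### Admissible utility functions -/

section Utility

theorem isOpen_utilityInterval (a : EReal) : IsOpen (utilityInterval a) :=
  isOpen_Ioi.preimage continuous_coe_real_ereal

theorem isUpperSet_utilityInterval (a : EReal) : IsUpperSet (utilityInterval a) :=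
  fun _ _ hxy hx => lt_of_lt_of_le hx (EReal.coe_le_coe_iff.2 hxy)

theorem convex_utilityInterval (a : EReal) : Convex ℝ (utilityInterval a) :=
  (isUpperSet_utilityInterval a).ordConnected.convex

namespace IsAdmissibleUtility

variable {U : ℝ → EReal} {a : EReal}

theorem coe_toReal (hU : IsAdmissibleUtility U a) {x : ℝ} (hx : x ∈ utilityInterval a) :
    ((U x).toReal : EReal) = U x :=
  EReal.coe_toReal (hU.ne_top x) (hU.ne_bot x hx)

theorem concaveOn (hU : IsAdmissibleUtility U a) :
    ConcaveOn ℝ (utilityInterval a) fun x => (U x).toReal := by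
  refine concaveOn_iff_forall_pos.2 ⟨convex_utilityInterval a, fun x hx y hy s t hs ht hst => ?_⟩
  have hz : s * x + t * y ∈ utilityInterval a :=
    convex_utilityInterval a hx hy hs.le ht.le hst
  have h := hU.concave x y s t hs ht hst
  rw [← hU.coe_toReal hx, ← hU.coe_toReal hy, ← hU.coe_toReal hz] at h
  exact_mod_cast h

theorem hasDerivAt (hU : IsAdmissibleUtility U a) {x : ℝ} (hx : x ∈ utilityInterval a) :
    HasDerivAt (fun x => (U x).toReal) (marginal U x) x :=
  (hU.differentiable.differentiableAt ((isOpen_utilityInterval a).mem_nhds hx)).hasDerivAt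

theorem strictAntiOn_marginal (hU : IsAdmissibleUtility U a) :
    StrictAntiOn (marginal U) (utilityInterval a) := by
  have h : AntitoneOn (marginal U) (utilityInterval a) :=
    hU.concaveOn.antitoneOn_deriv fun x hx => (hU.hasDerivAt hx).differentiableAt
  intro x hx y hy hxy
  exact lt_of_le_of_ne (h hx hy hxy.le) fun he => hxy.ne' (hU.injOn hy hx he)

theorem strictConcaveOn (hU : IsAdmissibleUtility U a) :
    StrictConcaveOn ℝ (utilityInterval a) fun x => (U x).toReal := by
  refine StrictAntiOn.strictConcaveOn_of_deriv (convex_utilityInterval a)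
    hU.differentiable.continuousOn ?_
  rw [(isOpen_utilityInterval a).interior_eq]
  exact hU.strictAntiOn_marginal

theorem toReal_lt_tangent (hU : IsAdmissibleUtility U a) {x y : ℝ} (hx : x ∈ utilityInterval a)
    (hy : y ∈ utilityInterval a) (hxy : y ≠ x) :
    (U y).toReal < (U x).toReal + marginal U x * (y - x) := by
  have hd := (hU.hasDerivAt hx).differentiableAt
  rcases lt_or_gt_of_ne hxy with h | h
  · have := hU.strictConcaveOn.deriv_lt_slope hy hx h hd
    rw [slope_def_field, lt_div_iff₀ (sub_pos.2 h)] at this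
    change marginal U x * (x - y) < _ at this
    linarith
  · have := hU.strictConcaveOn.slope_lt_deriv hx hy h hd
    rw [slope_def_field, div_lt_iff₀ (sub_pos.2 h)] at this
    change _ < marginal U x * (y - x) at this
    linarith

/-- The graph of `U` lies strictly below its tangents, also at the left end point of `A`. -/
theorem lt_tangent (hU : IsAdmissibleUtility U a) {x y : ℝ} (hx : x ∈ utilityInterval a)
    (hxy : y ≠ x) : U y < (((U x).toReal + marginal U x * (y - x) : ℝ) : EReal) := by
  rcases eq_or_ne (U y) ⊥ with hb | hb
  · rw [hb]
    exact EReal.bot_lt_coe _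
  by_cases hy : y ∈ utilityInterval a
  · rw [← hU.coe_toReal hy]
    exact_mod_cast hU.toReal_lt_tangent hx hy hxy
  -- `y` is the left end point of `A`: compare with the midpoint of `y` and `x`
  have hay : a ≤ y := not_lt.1 fun h => hb (hU.eq_bot y h)
  have hlt : y < x := lt_of_le_of_ne
    (not_lt.1 fun h => hy (isUpperSet_utilityInterval a h.le hx)) hxy
  have hz : 1 / 2 * y + 1 / 2 * x ∈ utilityInterval a :=
    lt_of_le_of_lt hay (EReal.coe_lt_coe_iff.2 (by linarith))
  have h1 := hU.concave y x (1 / 2) (1 / 2) (by norm_num) (by norm_num) (by norm_num)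
  have h2 := hU.toReal_lt_tangent hx hz (by linarith)
  rw [← hU.coe_toReal hz, ← hU.coe_toReal hx, ← EReal.coe_toReal (hU.ne_top y) hb] at h1
  rw [← EReal.coe_toReal (hU.ne_top y) hb]
  norm_cast at h1 ⊢
  linarith

theorem le_tangent (hU : IsAdmissibleUtility U a) {x : ℝ} (hx : x ∈ utilityInterval a) (y : ℝ) :
    U y ≤ (((U x).toReal + marginal U x * (y - x) : ℝ) : EReal) := by
  rcases eq_or_ne y x with rfl | h
  · simp [hU.coe_toReal hx]
  · exact (hU.lt_tangent hx h).le

theorem exists_lt_mem (a : EReal) {x : ℝ} (hx : x ∈ utilityInterval a) :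
    ∃ y ∈ utilityInterval a, y < x := by
  obtain ⟨y, hy, hyx⟩ := EReal.lt_iff_exists_real_btwn.1 hx
  exact ⟨y, hy, EReal.coe_lt_coe_iff.1 hyx⟩

theorem ordConnected_marginalRange (hU : IsAdmissibleUtility U a) :
    (marginalRange U a).OrdConnected :=
  ((convex_utilityInterval a).isPreconnected.image _
    hU.twice_differentiable.continuousOn).ordConnected

theorem isUpperSet_marginalRange (hU : IsAdmissibleUtility U a) :
    IsUpperSet (marginalRange U a) := by
  intro x y hxy hx
  obtain ⟨z, hz, hyz⟩ := not_bddAbove_iff.1 hU.sup_range y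
  exact hU.ordConnected_marginalRange.out hx hz ⟨hxy, hyz.le⟩

theorem exists_lt_marginalRange (hU : IsAdmissibleUtility U a) {y : ℝ}
    (hy : y ∈ marginalRange U a) : ∃ z ∈ marginalRange U a, z < y := by
  obtain ⟨x, hx, rfl⟩ := hy
  have hx1 := isUpperSet_utilityInterval a (lt_add_one x).le hx
  exact ⟨_, ⟨x + 1, hx1, rfl⟩, hU.strictAntiOn_marginal hx hx1 (lt_add_one x)⟩

theorem marginalRange_mem_nhds (hU : IsAdmissibleUtility U a) {y : ℝ}
    (hy : y ∈ marginalRange U a) : marginalRange U a ∈ 𝓝 y := by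
  obtain ⟨z, hz, hzy⟩ := hU.exists_lt_marginalRange hy
  exact mem_of_superset (Ici_mem_nhds hzy) fun w hw => hU.isUpperSet_marginalRange hw hz

/-- `B` is stable under multiplication by positive numbers: it is `]0, ∞[` or `ℝ`. -/
theorem mul_mem_marginalRange (hU : IsAdmissibleUtility U a) {y x : ℝ}
    (hy : y ∈ marginalRange U a) (hx : 0 < x) : y * x ∈ marginalRange U a := by
  have : ∃ z ∈ marginalRange U a, z < y * x := by
    rcases hU.inf_range with h | h
    · obtain ⟨z, hz, hzy⟩ := hU.exists_lt_marginalRange hy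
      obtain ⟨w, hw, hw'⟩ := h.exists_between (mul_pos ((h.1 hz).trans_lt hzy) hx)
      exact ⟨w, hw, hw'.2⟩
    · obtain ⟨z, hz, hzy⟩ := not_bddBelow_iff.1 h (y * x)
      exact ⟨z, hz, hzy⟩
  obtain ⟨z, hz, hzy⟩ := this
  exact hU.isUpperSet_marginalRange hzy.le hz

theorem inverseMarginal_mem {y : ℝ} (hy : y ∈ marginalRange U a) :
    inverseMarginal U a y ∈ utilityInterval a :=
  Function.invFunOn_mem hy

theorem marginal_inverseMarginal {y : ℝ} (hy : y ∈ marginalRange U a) :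
    marginal U (inverseMarginal U a y) = y :=
  Function.invFunOn_eq hy

theorem inverseMarginal_marginal (hU : IsAdmissibleUtility U a) {x : ℝ}
    (hx : x ∈ utilityInterval a) : inverseMarginal U a (marginal U x) = x :=
  hU.injOn.leftInvOn_invFunOn hx

theorem strictAntiOn_inverseMarginal (hU : IsAdmissibleUtility U a) :
    StrictAntiOn (inverseMarginal U a) (marginalRange U a) := by
  intro y hy z hz hyz
  rw [← hU.strictAntiOn_marginal.lt_iff_gt (inverseMarginal_mem hy) (inverseMarginal_mem hz),
    marginal_inverseMarginal hy, marginal_inverseMarginal hz]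
  exact hyz

theorem image_inverseMarginal (hU : IsAdmissibleUtility U a) :
    inverseMarginal U a '' marginalRange U a = utilityInterval a := by
  refine Set.Subset.antisymm (Set.image_subset_iff.2 fun y hy => inverseMarginal_mem hy) ?_
  exact fun x hx => ⟨marginal U x, ⟨x, hx, rfl⟩, hU.inverseMarginal_marginal hx⟩

theorem continuousAt_inverseMarginal (hU : IsAdmissibleUtility U a) {y : ℝ}
    (hy : y ∈ marginalRange U a) : ContinuousAt (inverseMarginal U a) y := by
  have h : ContinuousAt (fun z => -inverseMarginal U a z) y := by
    refine StrictMonoOn.continuousAt_of_image_mem_nhds (s := marginalRange U a)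
      (fun z hz w hw hzw => neg_lt_neg (hU.strictAntiOn_inverseMarginal hz hw hzw))
      (hU.marginalRange_mem_nhds hy) ?_
    have : (fun z => -inverseMarginal U a z) '' marginalRange U a = -utilityInterval a := by
      rw [← hU.image_inverseMarginal, ← Set.image_neg_eq_neg, Set.image_image]
    rw [this]
    exact (isOpen_utilityInterval a).neg.mem_nhds (by simpa using inverseMarginal_mem hy)
  exact h.neg.congr (Eventually.of_forall fun z => neg_neg _)

end IsAdmissibleUtility

end Utility

/-! ### Expectations with values in the extended reals -/

section ExtExpectation

variable {Ω : Type*} [MeasurableSpace Ω] {P : Measure Ω}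

theorem posExpectation_mono {f g : Ω → EReal} (h : ∀ ω, f ω ≤ g ω) :
    posExpectation P f ≤ posExpectation P g :=
  lintegral_mono fun ω => EReal.toENNReal_le_toENNReal (h ω)

theorem extExpectation_mono {f g : Ω → EReal} (h : ∀ ω, f ω ≤ g ω) :
    extExpectation P f ≤ extExpectation P g :=
  EReal.sub_le_sub (EReal.coe_ennreal_le_coe_ennreal_iff.2 (posExpectation_mono h))
    (EReal.coe_ennreal_le_coe_ennreal_iff.2
      (posExpectation_mono fun ω => EReal.neg_le_neg_iff.2 (h ω)))

theorem posExpectation_coe_ne_top {f : Ω → ℝ} (hf : Integrable f P) :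
    posExpectation P (fun ω => (f ω : EReal)) ≠ ⊤ := by
  simp only [posExpectation, EReal.real_coe_toENNReal]
  exact hf.lintegral_lt_top.ne

theorem extExpectation_coe {f : Ω → ℝ} (hf : Integrable f P) :
    extExpectation P (fun ω => (f ω : EReal)) = ((∫ ω, f ω ∂P : ℝ) : EReal) := by
  have h1 := posExpectation_coe_ne_top hf
  have h2 := posExpectation_coe_ne_top hf.neg
  simp only [posExpectation, EReal.real_coe_toENNReal, Pi.neg_apply] at h1 h2
  simp only [extExpectation, posExpectation, ← EReal.coe_neg, EReal.real_coe_toENNReal]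
  rw [integral_eq_lintegral_pos_part_sub_lintegral_neg_part hf, EReal.coe_sub,
    EReal.coe_ennreal_toReal h1, EReal.coe_ennreal_toReal h2]

/-- A function which is dominated by an integrable function and has the same expectation
coincides with it. -/
theorem ae_eq_of_le_extExpectation {f : Ω → EReal} {l : Ω → ℝ} (hf : AEMeasurable f P)
    (hl : Integrable l P) (hle : ∀ ω, f ω ≤ l ω)
    (h : ((∫ ω, l ω ∂P : ℝ) : EReal) ≤ extExpectation P f) : f =ᵐ[P] fun ω => (l ω : EReal) := by
  have hneg : ∀ ω, -(l ω : EReal) ≤ -f ω := fun ω => EReal.neg_le_neg_iff.2 (hle ω)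
  have hp := posExpectation_mono (P := P) hle
  have hn := posExpectation_mono (P := P) hneg
  have hlp := posExpectation_coe_ne_top hl
  have hln : posExpectation P (fun ω => -(l ω : EReal)) ≠ ⊤ := by
    simpa only [Pi.neg_apply, EReal.coe_neg] using posExpectation_coe_ne_top hl.neg
  have hfp := ne_top_of_le_ne_top hlp hp
  rw [← extExpectation_coe hl, extExpectation, extExpectation] at h
  have hfn : posExpectation P (fun ω => -f ω) ≠ ⊤ := by
    intro ht
    rw [ht, EReal.coe_ennreal_top, ← EReal.coe_ennreal_toReal hfp, ← EReal.coe_ennreal_toReal hlp,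
      ← EReal.coe_ennreal_toReal hln, EReal.sub_top, ← EReal.coe_sub] at h
    exact absurd h (not_le.2 (EReal.bot_lt_coe _))
  have hp' := (ENNReal.toReal_le_toReal hfp hlp).2 hp
  have hn' := (ENNReal.toReal_le_toReal hln hfn).2 hn
  rw [← EReal.coe_ennreal_toReal hfp, ← EReal.coe_ennreal_toReal hlp,
    ← EReal.coe_ennreal_toReal hln, ← EReal.coe_ennreal_toReal hfn, ← EReal.coe_sub,
    ← EReal.coe_sub, EReal.coe_le_coe_iff] at h
  have hml : AEMeasurable (fun ω => (l ω : EReal)) P := hl.1.aemeasurable.coe_real_ereal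
  have e1 := ae_eq_of_ae_le_of_lintegral_le
    (Eventually.of_forall fun ω => EReal.toENNReal_le_toENNReal (hle ω)) hfp hml.ereal_toENNReal
    ((ENNReal.toReal_le_toReal hlp hfp).1 (by linarith))
  have e2 := ae_eq_of_ae_le_of_lintegral_le
    (Eventually.of_forall fun ω => EReal.toENNReal_le_toENNReal (hneg ω)) hln
    hf.neg.ereal_toENNReal ((ENNReal.toReal_le_toReal hfn hln).1 (by linarith))
  filter_upwards [e1, e2] with ω h1 h2
  rcases le_or_gt (f ω) 0 with h0 | h0
  · have h0' : 0 ≤ -f ω := by rwa [EReal.le_neg, neg_zero]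
    have h3 := congrArg ((↑) : ℝ≥0∞ → EReal) h2
    rw [EReal.coe_toENNReal h0', EReal.coe_toENNReal_eq_max] at h3
    refine le_antisymm (hle ω) ?_
    rcases le_total 0 (-(l ω : EReal)) with h4 | h4
    · rw [max_eq_right h4] at h3
      exact (neg_injective h3).le
    · rw [max_eq_left h4] at h3
      have h5 : f ω = 0 := by rw [← neg_neg (f ω), ← h3, neg_zero]
      rw [h5, EReal.toENNReal_zero, eq_comm, EReal.toENNReal_eq_zero_iff] at h1
      rwa [h5]
  · have h3 := congrArg ((↑) : ℝ≥0∞ → EReal) h1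
    rwa [EReal.coe_toENNReal h0.le, EReal.coe_toENNReal (h0.le.trans (hle ω))] at h3

end ExtExpectation

/-! ### The candidates `I(λξ)` -/

section Candidate

variable {Ω : Type*} {𝒢 : MeasurableSpace Ω} [mΩ : MeasurableSpace Ω] {P : Measure Ω}
  {U : ℝ → EReal} {a : EReal} {ξ : Ω → ℝ}

namespace IsStatePriceDensity

theorem memLp_rpow (hξ : IsStatePriceDensity 𝒢 P ξ) (p : ℝ) : MemLp (fun ω => ξ ω ^ p) 2 P := by
  rw [memLp_two_iff_integrable_sq (hξ.integrable_rpow p).1]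
  refine (hξ.integrable_rpow (p * (2 : ℕ))).congr (Eventually.of_forall fun ω => ?_)
  exact Real.rpow_mul_natCast (hξ.pos ω).le p 2

theorem memLp (hξ : IsStatePriceDensity 𝒢 P ξ) : MemLp ξ 2 P := by
  simpa only [Real.rpow_one] using hξ.memLp_rpow 1

theorem integrable_mul (hξ : IsStatePriceDensity 𝒢 P ξ) {X : Ω → ℝ} (hX : MemLp X 2 P) :
    Integrable (fun ω => ξ ω * X ω) P :=
  hξ.memLp.integrable_mul hX

end IsStatePriceDensity

namespace IsAdmissibleUtility

theorem measurable (hU : IsAdmissibleUtility U a) : Measurable U :=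
  hU.usc.measurable

theorem aestronglyMeasurable_candidate {m : MeasurableSpace Ω} (hU : IsAdmissibleUtility U a)
    (hpos : ∀ ω, 0 < ξ ω) (hm : AEStronglyMeasurable[m] ξ P) {lam : ℝ}
    (hlam : lam ∈ marginalRange U a) : AEStronglyMeasurable[m] (candidate U a ξ lam) P := by
  obtain ⟨ζ, hζ, he⟩ := hm
  -- `I(λ ·)` is continuous only on the positive half line; the substitution `exp` makes it global
  have hc : Continuous fun x => inverseMarginal U a (lam * Real.exp x) :=
    continuous_iff_continuousAt.2 fun x => ContinuousAt.comp
      (hU.continuousAt_inverseMarginal (hU.mul_mem_marginalRange hlam (Real.exp_pos x)))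
      (by fun_prop)
  refine ⟨fun ω => inverseMarginal U a (lam * Real.exp (Real.log (ζ ω))),
    hc.comp_stronglyMeasurable (Real.measurable_log.comp hζ.measurable).stronglyMeasurable, ?_⟩
  filter_upwards [he] with ω hω
  rw [← hω, Real.exp_log (hpos ω), candidate]

theorem candidate_mem (hU : IsAdmissibleUtility U a) (hξ : IsStatePriceDensity 𝒢 P ξ) {lam : ℝ}
    (hlam : lam ∈ marginalRange U a) (ω : Ω) : candidate U a ξ lam ω ∈ utilityInterval a :=
  inverseMarginal_mem (hU.mul_mem_marginalRange hlam (hξ.pos ω))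

theorem marginal_candidate (hU : IsAdmissibleUtility U a) (hξ : IsStatePriceDensity 𝒢 P ξ)
    {lam : ℝ} (hlam : lam ∈ marginalRange U a) (ω : Ω) :
    marginal U (candidate U a ξ lam ω) = lam * ξ ω :=
  marginal_inverseMarginal (hU.mul_mem_marginalRange hlam (hξ.pos ω))

theorem candidate_lt_candidate (hU : IsAdmissibleUtility U a) (hξ : IsStatePriceDensity 𝒢 P ξ)
    {lam mu : ℝ} (hlam : lam ∈ marginalRange U a) (hmu : mu ∈ marginalRange U a) (h : lam < mu)
    (ω : Ω) : candidate U a ξ mu ω < candidate U a ξ lam ω :=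
  hU.strictAntiOn_inverseMarginal (hU.mul_mem_marginalRange hlam (hξ.pos ω))
    (hU.mul_mem_marginalRange hmu (hξ.pos ω)) (mul_lt_mul_of_pos_right h (hξ.pos ω))

theorem candidate_antitone (hU : IsAdmissibleUtility U a) (hξ : IsStatePriceDensity 𝒢 P ξ)
    {lam mu : ℝ} (hlam : lam ∈ marginalRange U a) (hmu : mu ∈ marginalRange U a) (h : lam ≤ mu)
    (ω : Ω) : candidate U a ξ mu ω ≤ candidate U a ξ lam ω := by
  rcases h.eq_or_lt with rfl | h
  · exact le_rfl
  · exact (hU.candidate_lt_candidate hξ hlam hmu h ω).le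

/-- The tangent to `U` at the candidate, evaluated at `X`. -/
def tangentAtCandidate (U : ℝ → EReal) (a : EReal) (ξ : Ω → ℝ) (lam : ℝ) (X : Ω → ℝ) (ω : Ω) : ℝ :=
  (U (candidate U a ξ lam ω)).toReal + lam * (ξ ω * (X ω - candidate U a ξ lam ω))

theorem le_tangentAtCandidate (hU : IsAdmissibleUtility U a) (hξ : IsStatePriceDensity 𝒢 P ξ)
    {lam : ℝ} (hlam : lam ∈ marginalRange U a) (X : Ω → ℝ) (ω : Ω) :
    U (X ω) ≤ (tangentAtCandidate U a ξ lam X ω : EReal) := by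
  have := hU.le_tangent (hU.candidate_mem hξ hlam ω) (X ω)
  rwa [hU.marginal_candidate hξ hlam, mul_assoc] at this

theorem lt_tangentAtCandidate (hU : IsAdmissibleUtility U a) (hξ : IsStatePriceDensity 𝒢 P ξ)
    {lam : ℝ} (hlam : lam ∈ marginalRange U a) {X : Ω → ℝ} {ω : Ω}
    (hne : X ω ≠ candidate U a ξ lam ω) :
    U (X ω) < (tangentAtCandidate U a ξ lam X ω : EReal) := by
  have := hU.lt_tangent (hU.candidate_mem hξ hlam ω) hne
  rwa [hU.marginal_candidate hξ hlam, mul_assoc] at this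

variable [IsProbabilityMeasure P]

/-- The candidates are square integrable, since `I` grows at most like a sum of a positive and a
negative power and `ξ` has moments of all orders. The case `λ = 0`, where the estimate for `I` is
not available, is that of a constant. -/
theorem memLp_candidate (hU : IsAdmissibleUtility U a) (hξ : IsStatePriceDensity 𝒢 P ξ) {lam : ℝ}
    (hlam : lam ∈ marginalRange U a) : MemLp (candidate U a ξ lam) 2 P := by
  rcases eq_or_ne lam 0 with rfl | h0
  · have hc : candidate U a ξ 0 = fun _ => inverseMarginal U a 0 := by
      ext ω
      rw [candidate, zero_mul]
    rw [hc]
    exact memLp_const _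
  obtain ⟨r, c₁, c₂, c₃, -, -, -, -, hest⟩ := hU.estimate
  have hb : MemLp (fun ω => c₁ + c₂ * |lam| ^ r * ξ ω ^ r + c₃ * |lam| ^ (-r) * ξ ω ^ (-r)) 2 P :=
    ((memLp_const c₁).add ((hξ.memLp_rpow r).const_mul _)).add ((hξ.memLp_rpow (-r)).const_mul _)
  refine hb.mono (hU.aestronglyMeasurable_candidate hξ.pos hξ.memLp.1 hlam)
    (Eventually.of_forall fun ω => ?_)
  have h1 := (hest _ (hU.mul_mem_marginalRange hlam (hξ.pos ω))
    (mul_ne_zero h0 (hξ.pos ω).ne')).2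
  rw [abs_mul lam, abs_of_pos (hξ.pos ω), Real.mul_rpow (abs_nonneg _) (hξ.pos ω).le,
    Real.mul_rpow (abs_nonneg _) (hξ.pos ω).le] at h1
  rw [Real.norm_eq_abs, Real.norm_eq_abs]
  refine le_trans ?_ (le_abs_self _)
  have h2 := abs_nonneg (lam * ξ ω * deriv (inverseMarginal U a) (lam * ξ ω))
  rw [candidate]
  linarith

/-- The utility of a candidate lies between two integrable random variables, by the tangent
inequalities at the candidate and at an arbitrary point of `A`. -/
theorem integrable_utility_candidate (hU : IsAdmissibleUtility U a)
    (hξ : IsStatePriceDensity 𝒢 P ξ) {lam : ℝ} (hlam : lam ∈ marginalRange U a) :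
    Integrable (fun ω => (U (candidate U a ξ lam ω)).toReal) P := by
  have hX := hU.memLp_candidate hξ hlam
  obtain ⟨x, hx, -⟩ := id hlam
  have hle : ∀ y ∈ utilityInterval a, ∀ z ∈ utilityInterval a,
      (U z).toReal ≤ (U y).toReal + marginal U y * (z - y) := by
    intro y hy z hz
    have := hU.le_tangent hy z
    rw [← hU.coe_toReal hz] at this
    exact_mod_cast this
  have hXi : Integrable (candidate U a ξ lam) P := hX.integrable one_le_two
  refine integrable_of_le_of_le
    (g₁ := fun ω => (U x).toReal - lam * (ξ ω * (x - candidate U a ξ lam ω)))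
    (g₂ := fun ω => (U x).toReal + marginal U x * (candidate U a ξ lam ω - x))
    ?_ (Eventually.of_forall fun ω => ?_) (Eventually.of_forall fun ω => ?_) ?_ ?_
  · exact (measurable_ereal_toReal.comp_aemeasurable
      (hU.measurable.comp_aemeasurable hX.1.aemeasurable)).aestronglyMeasurable
  · have := hle _ (hU.candidate_mem hξ hlam ω) x hx
    rw [hU.marginal_candidate hξ hlam] at this
    linarith
  · exact hle x hx _ (hU.candidate_mem hξ hlam ω)
  · exact (integrable_const _).sub ((hξ.integrable_mul ((memLp_const x).sub hX)).const_mul lam)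
  · exact (integrable_const _).add ((hXi.sub (integrable_const x)).const_mul _)

/-! ### The multiplier -/

theorem strictAntiOn_budget (hU : IsAdmissibleUtility U a) (hξ : IsStatePriceDensity 𝒢 P ξ) :
    StrictAntiOn (fun lam => ∫ ω, ξ ω * candidate U a ξ lam ω ∂P) (marginalRange U a) := by
  intro lam hlam mu hmu h
  have h1 := hξ.integrable_mul (hU.memLp_candidate hξ hlam)
  have h2 := hξ.integrable_mul (hU.memLp_candidate hξ hmu)
  have hlt : ∀ ω, ξ ω * candidate U a ξ mu ω < ξ ω * candidate U a ξ lam ω := fun ω =>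
    mul_lt_mul_of_pos_left (hU.candidate_lt_candidate hξ hlam hmu h ω) (hξ.pos ω)
  refine lt_of_le_of_ne (integral_mono h2 h1 fun ω => (hlt ω).le) fun he => ?_
  have := (integral_eq_iff_of_ae_le h2 h1 (Eventually.of_forall fun ω => (hlt ω).le)).1 he
  obtain ⟨ω, hω⟩ := this.exists
  exact (hlt ω).ne hω

theorem continuousOn_budget (hU : IsAdmissibleUtility U a) (hξ : IsStatePriceDensity 𝒢 P ξ) :
    ContinuousOn (fun lam => ∫ ω, ξ ω * candidate U a ξ lam ω ∂P) (marginalRange U a) := by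
  intro lam hlam
  refine ContinuousAt.continuousWithinAt ?_
  obtain ⟨mu, hmu, hlt⟩ := hU.exists_lt_marginalRange hlam
  have hnu := hU.isUpperSet_marginalRange (lt_add_one lam).le hlam
  refine continuousAt_of_dominated
    (bound := fun ω => ξ ω * (|candidate U a ξ mu ω| + |candidate U a ξ (lam + 1) ω|)) ?_ ?_ ?_ ?_
  · filter_upwards [hU.marginalRange_mem_nhds hlam] with l hl
    exact (hξ.integrable_mul (hU.memLp_candidate hξ hl)).1
  · filter_upwards [hU.marginalRange_mem_nhds hlam, Ioo_mem_nhds hlt (lt_add_one lam)]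
      with l hl hl'
    refine Eventually.of_forall fun ω => ?_
    rw [norm_mul, Real.norm_of_nonneg (hξ.pos ω).le, Real.norm_eq_abs]
    refine mul_le_mul_of_nonneg_left (abs_le.2 ⟨?_, ?_⟩) (hξ.pos ω).le
    · have := hU.candidate_antitone hξ hl hnu hl'.2.le ω
      linarith [neg_abs_le (candidate U a ξ (lam + 1) ω), abs_nonneg (candidate U a ξ mu ω)]
    · have := hU.candidate_antitone hξ hmu hl hl'.1.le ω
      linarith [le_abs_self (candidate U a ξ mu ω), abs_nonneg (candidate U a ξ (lam + 1) ω)]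
  · exact hξ.integrable_mul
      ((hU.memLp_candidate hξ hmu).abs.add (hU.memLp_candidate hξ hnu).abs)
  · refine Eventually.of_forall fun ω => continuousAt_const.mul ?_
    exact ContinuousAt.comp (f := fun l : ℝ => l * ξ ω)
      (hU.continuousAt_inverseMarginal (hU.mul_mem_marginalRange hlam (hξ.pos ω)))
      (by fun_prop)

/-- Multipliers `l n` which, multiplied by a fixed positive number, get below every element of `B`:
they tend to `inf B`, which is `0` or `-∞`. -/
theorem exists_seq_mul_le (hU : IsAdmissibleUtility U a) :
    ∃ l : ℕ → ℝ, (∀ n, l n ∈ marginalRange U a) ∧ (∀ n, l n ≤ l 0) ∧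
      ∀ x : ℝ, 0 < x → ∀ y ∈ marginalRange U a, ∀ᶠ n in atTop, l n * x ≤ y := by
  rcases hU.inf_range with h | h
  · obtain ⟨z, hz, -⟩ := not_bddAbove_iff.1 hU.sup_range 0
    have hz0 : ∀ y ∈ marginalRange U a, 0 < y := fun y hy => by
      obtain ⟨w, hw, hwy⟩ := hU.exists_lt_marginalRange hy
      exact (h.1 hw).trans_lt hwy
    refine ⟨fun n => z * (1 / ((n : ℝ) + 1)),
      fun n => hU.mul_mem_marginalRange hz (by positivity), fun n => ?_, fun x hx y hy => ?_⟩
    · refine mul_le_mul_of_nonneg_left ?_ (hz0 z hz).le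
      simpa using inv_le_one_of_one_le₀ (by linarith [n.cast_nonneg (α := ℝ)] : 1 ≤ (n : ℝ) + 1)
    · have := ((tendsto_one_div_add_atTop_nhds_zero_nat (𝕜 := ℝ)).const_mul z).mul_const x
      rw [mul_zero, zero_mul] at this
      exact this.eventually_le_const (hz0 y hy)
  · have huniv : ∀ y, y ∈ marginalRange U a := fun y => by
      obtain ⟨w, hw, hwy⟩ := not_bddBelow_iff.1 h y
      exact hU.isUpperSet_marginalRange hwy.le hw
    refine ⟨fun n => -n, fun n => huniv _, fun n => by simp, fun x hx y _ => ?_⟩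
    exact ((tendsto_neg_atTop_atBot.comp tendsto_natCast_atTop_atTop).atBot_mul_const
      hx).eventually_le_atBot y

theorem exists_seq_le_mul (hU : IsAdmissibleUtility U a) :
    ∃ l : ℕ → ℝ, (∀ n, l n ∈ marginalRange U a) ∧ (∀ n, l 0 ≤ l n) ∧
      ∀ x : ℝ, 0 < x → ∀ y, ∀ᶠ n in atTop, y ≤ l n * x := by
  obtain ⟨z, hz, -⟩ := not_bddAbove_iff.1 hU.sup_range 0
  refine ⟨fun n => z + n, fun n => hU.isUpperSet_marginalRange (by simp) hz, fun n => by simp,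
    fun x hx y => ?_⟩
  exact ((tendsto_atTop_add_const_left _ z tendsto_natCast_atTop_atTop).atTop_mul_const
    hx).eventually_ge_atTop y

/-- For large multipliers the budget is small: the expectations `E[ξ max(I(λξ), b)]` decrease to
`E[ξ] b = b` as `λ → ∞`, and `A` contains some `b < v`. -/
theorem exists_budget_lt (hU : IsAdmissibleUtility U a) (hξ : IsStatePriceDensity 𝒢 P ξ) {v : ℝ}
    (hv : v ∈ utilityInterval a) :
    ∃ lam ∈ marginalRange U a, ∫ ω, ξ ω * candidate U a ξ lam ω ∂P < v := by
  obtain ⟨b, hb, hbv⟩ := exists_lt_mem a hv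
  obtain ⟨l, hl, hl0, hlim⟩ := hU.exists_seq_le_mul
  have hX := fun n => hU.memLp_candidate hξ (hl n)
  have hmax := fun n => hξ.integrable_mul ((hX n).sup (memLp_const b))
  have ht : Tendsto (fun n => ∫ ω, ξ ω * max (candidate U a ξ (l n) ω) b ∂P) atTop
      (𝓝 (∫ ω, ξ ω * b ∂P)) := by
    refine tendsto_integral_of_dominated_convergence
      (fun ω => ξ ω * (|candidate U a ξ (l 0) ω| + |b|)) (fun n => (hmax n).1)
      (hξ.integrable_mul ((hX 0).abs.add (memLp_const |b|)))
      (fun n => Eventually.of_forall fun ω => ?_) (Eventually.of_forall fun ω => ?_)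
    · rw [norm_mul, Real.norm_of_nonneg (hξ.pos ω).le, Real.norm_eq_abs]
      refine mul_le_mul_of_nonneg_left (abs_le.2 ⟨?_, max_le ?_ ?_⟩) (hξ.pos ω).le
      · linarith [le_max_right (candidate U a ξ (l n) ω) b, neg_abs_le b,
          abs_nonneg (candidate U a ξ (l 0) ω)]
      · linarith [hU.candidate_antitone hξ (hl 0) (hl n) (hl0 n) ω, abs_nonneg b,
          le_abs_self (candidate U a ξ (l 0) ω)]
      · linarith [le_abs_self b, abs_nonneg (candidate U a ξ (l 0) ω)]
    · refine tendsto_const_nhds.congr' ?_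
      filter_upwards [hlim (ξ ω) (hξ.pos ω) (marginal U b)] with n hn
      rw [max_eq_right]
      have := hU.strictAntiOn_inverseMarginal.antitoneOn ⟨b, hb, rfl⟩
        (hU.mul_mem_marginalRange (hl n) (hξ.pos ω)) hn
      rwa [hU.inverseMarginal_marginal hb] at this
  rw [integral_mul_const, hξ.integral_eq_one, one_mul] at ht
  obtain ⟨n, hn⟩ := (ht.eventually_lt_const hbv).exists
  refine ⟨l n, hl n, lt_of_le_of_lt ?_ hn⟩
  exact integral_mono (hξ.integrable_mul (hX n)) (hmax n) fun ω =>
    mul_le_mul_of_nonneg_left (le_max_left _ _) (hξ.pos ω).le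

/-- For small multipliers the budget is large: the expectations `E[ξ min(I(λξ), b)]` increase to
`E[ξ] b = b` as `λ → inf B`, where `b > v`. -/
theorem exists_lt_budget (hU : IsAdmissibleUtility U a) (hξ : IsStatePriceDensity 𝒢 P ξ) {v : ℝ}
    (hv : v ∈ utilityInterval a) :
    ∃ lam ∈ marginalRange U a, v < ∫ ω, ξ ω * candidate U a ξ lam ω ∂P := by
  obtain ⟨b, hb, hvb⟩ : ∃ b ∈ utilityInterval a, v < b :=
    ⟨v + 1, isUpperSet_utilityInterval a (lt_add_one v).le hv, lt_add_one v⟩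
  obtain ⟨l, hl, hl0, hlim⟩ := hU.exists_seq_mul_le
  have hX := fun n => hU.memLp_candidate hξ (hl n)
  have hmin := fun n => hξ.integrable_mul ((hX n).inf (memLp_const b))
  have ht : Tendsto (fun n => ∫ ω, ξ ω * min (candidate U a ξ (l n) ω) b ∂P) atTop
      (𝓝 (∫ ω, ξ ω * b ∂P)) := by
    refine tendsto_integral_of_dominated_convergence
      (fun ω => ξ ω * (|candidate U a ξ (l 0) ω| + |b|)) (fun n => (hmin n).1)
      (hξ.integrable_mul ((hX 0).abs.add (memLp_const |b|)))
      (fun n => Eventually.of_forall fun ω => ?_) (Eventually.of_forall fun ω => ?_)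
    · rw [norm_mul, Real.norm_of_nonneg (hξ.pos ω).le, Real.norm_eq_abs]
      refine mul_le_mul_of_nonneg_left (abs_le.2 ⟨le_min ?_ ?_, ?_⟩) (hξ.pos ω).le
      · linarith [hU.candidate_antitone hξ (hl n) (hl 0) (hl0 n) ω, abs_nonneg b,
          neg_abs_le (candidate U a ξ (l 0) ω)]
      · linarith [neg_abs_le b, abs_nonneg (candidate U a ξ (l 0) ω)]
      · linarith [min_le_right (candidate U a ξ (l n) ω) b, le_abs_self b,
          abs_nonneg (candidate U a ξ (l 0) ω)]
    · refine tendsto_const_nhds.congr' ?_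
      filter_upwards [hlim (ξ ω) (hξ.pos ω) (marginal U b) ⟨b, hb, rfl⟩] with n hn
      rw [min_eq_right]
      have := hU.strictAntiOn_inverseMarginal.antitoneOn
        (hU.mul_mem_marginalRange (hl n) (hξ.pos ω)) ⟨b, hb, rfl⟩ hn
      rwa [hU.inverseMarginal_marginal hb] at this
  rw [integral_mul_const, hξ.integral_eq_one, one_mul] at ht
  obtain ⟨n, hn⟩ := (ht.eventually_const_lt hvb).exists
  refine ⟨l n, hl n, lt_of_lt_of_le hn ?_⟩
  exact integral_mono (hmin n) (hξ.integrable_mul (hX n)) fun ω =>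
    mul_le_mul_of_nonneg_left (min_le_left _ _) (hξ.pos ω).le

theorem existsUnique_isMultiplier (hU : IsAdmissibleUtility U a)
    (hξ : IsStatePriceDensity 𝒢 P ξ) {v : ℝ} (hv : v ∈ utilityInterval a) :
    ∃! lam, IsMultiplier P U a ξ v lam := by
  obtain ⟨l₁, h₁, hlt₁⟩ := hU.exists_budget_lt hξ hv
  obtain ⟨l₂, h₂, hlt₂⟩ := hU.exists_lt_budget hξ hv
  obtain ⟨lam, hlam, he⟩ := hU.ordConnected_marginalRange.isPreconnected.intermediate_value h₁ h₂
    (hU.continuousOn_budget hξ) ⟨hlt₁.le, hlt₂.le⟩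
  refine ⟨lam, ⟨hlam, he⟩, fun mu hmu => ?_⟩
  exact (hU.strictAntiOn_budget hξ).injOn hmu.1 hlam (hmu.2.trans he.symm)

/-! ### Optimality -/

theorem posExpectation_ne_top (hU : IsAdmissibleUtility U a) {v : ℝ} (hv : v ∈ utilityInterval a)
    {X : Ω → ℝ} (hX : MemLp X 2 P) : posExpectation P (fun ω => U (X ω)) ≠ ⊤ := by
  have hi : Integrable (fun ω => (U v).toReal + marginal U v * (X ω - v)) P :=
    (integrable_const _).add (((hX.integrable one_le_two).sub (integrable_const v)).const_mul _)
  exact ne_top_of_le_ne_top (posExpectation_coe_ne_top hi)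
    (posExpectation_mono fun ω => hU.le_tangent hv (X ω))

theorem extExpectation_candidate (hU : IsAdmissibleUtility U a)
    (hξ : IsStatePriceDensity 𝒢 P ξ) {lam : ℝ} (hlam : lam ∈ marginalRange U a) :
    extExpectation P (fun ω => U (candidate U a ξ lam ω)) =
      ((∫ ω, (U (candidate U a ξ lam ω)).toReal ∂P : ℝ) : EReal) := by
  rw [← extExpectation_coe (hU.integrable_utility_candidate hξ hlam)]
  simp only [hU.coe_toReal (hU.candidate_mem hξ hlam _)]

theorem integrable_tangentAtCandidate (hU : IsAdmissibleUtility U a)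
    (hξ : IsStatePriceDensity 𝒢 P ξ) {lam : ℝ} (hlam : lam ∈ marginalRange U a) {X : Ω → ℝ}
    (hX : MemLp X 2 P) : Integrable (tangentAtCandidate U a ξ lam X) P :=
  (hU.integrable_utility_candidate hξ hlam).add
    ((hξ.integrable_mul (hX.sub (hU.memLp_candidate hξ hlam))).const_mul lam)

/-- On the budget set the tangents at the candidate all have the same expectation, namely the
expected utility of the candidate. -/
theorem integral_tangentAtCandidate (hU : IsAdmissibleUtility U a)
    (hξ : IsStatePriceDensity 𝒢 P ξ) {v lam : ℝ} (hlam : IsMultiplier P U a ξ v lam) {X : Ω → ℝ}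
    (hX : IsFeasible 𝒢 P ξ v X) :
    ((∫ ω, tangentAtCandidate U a ξ lam X ω ∂P : ℝ) : EReal) =
      extExpectation P (fun ω => U (candidate U a ξ lam ω)) := by
  have hC := hU.memLp_candidate hξ hlam.1
  have hi : Integrable (fun ω => ξ ω * (X ω - candidate U a ξ lam ω)) P :=
    hξ.integrable_mul (hX.memLp.sub hC)
  rw [hU.extExpectation_candidate hξ hlam.1]
  congr 1
  have h0 : ∫ ω, ξ ω * (X ω - candidate U a ξ lam ω) ∂P = 0 := by
    simp only [mul_sub]
    rw [integral_sub (hξ.integrable_mul hX.memLp) (hξ.integrable_mul hC), hX.budget, hlam.2,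
      sub_self]
  unfold tangentAtCandidate
  rw [integral_add (hU.integrable_utility_candidate hξ hlam.1) (hi.const_mul lam),
    integral_const_mul, h0, mul_zero, add_zero]

theorem isMaximiser_candidate (hU : IsAdmissibleUtility U a) (hξ : IsStatePriceDensity 𝒢 P ξ)
    {v lam : ℝ} (hlam : IsMultiplier P U a ξ v lam) :
    IsMaximiser 𝒢 P ξ v U (candidate U a ξ lam) := by
  refine ⟨⟨hU.aestronglyMeasurable_candidate hξ.pos hξ.measurable hlam.1,
    hU.memLp_candidate hξ hlam.1, hlam.2⟩, fun X hX => ?_⟩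
  rw [← hU.integral_tangentAtCandidate hξ hlam hX,
    ← extExpectation_coe (hU.integrable_tangentAtCandidate hξ hlam.1 hX.memLp)]
  exact extExpectation_mono (hU.le_tangentAtCandidate hξ hlam.1 X)

theorem ae_eq_candidate_of_isMaximiser (hU : IsAdmissibleUtility U a)
    (hξ : IsStatePriceDensity 𝒢 P ξ) {v lam : ℝ} (hlam : IsMultiplier P U a ξ v lam) {X : Ω → ℝ}
    (hX : IsMaximiser 𝒢 P ξ v U X) : X =ᵐ[P] candidate U a ξ lam := by
  have h := hX.optimal _ (hU.isMaximiser_candidate hξ hlam).feasible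
  rw [← hU.integral_tangentAtCandidate hξ hlam hX.feasible] at h
  have he := ae_eq_of_le_extExpectation
    (hU.measurable.comp_aemeasurable hX.feasible.memLp.1.aemeasurable)
    (hU.integrable_tangentAtCandidate hξ hlam.1 hX.feasible.memLp)
    (hU.le_tangentAtCandidate hξ hlam.1 X) h
  filter_upwards [he] with ω hω
  by_contra hne
  exact (hU.lt_tangentAtCandidate hξ hlam.1 hne).ne hω

end IsAdmissibleUtility

end Candidate

end

theorem mainTheorem5 {Ω ι : Type*} [Countable ι] [MeasurableSpace Ω]
    (P : Measure Ω) [IsProbabilityMeasure P] (T : ℝ≥0)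
    (W : ι → ℝ≥0 → Ω → ℝ) (hWm : ∀ i t, Measurable (W i t))
    (hW : IsBrownianFamilyOn P T W)
    (γ : ℝ≥0 → Ω → Ell2 ι)
    (hγ : IsStronglyProgressive (generatedFiltration P W hWm) γ)
    (hγexp : HasExpMoments P T γ)
    (ξ : Ω → ℝ) (hξ : ξ = girsanovDensity P (generatedFiltration P W hWm) W T γ)
    (U : ℝ → EReal) (a : EReal) (hU : IsAdmissibleUtility U a)
    (v : ℝ) (hv : v ∈ utilityInterval a) :
    -- the scalar product `E[ξ X]` is well defined on `L²`
    MemLp ξ 2 P ∧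
    -- `E[U(X)] ∈ [-∞, ∞[` is well defined on `L²`
    (∀ X : Ω → ℝ, MemLp X 2 P → posExpectation P (fun ω => U (X ω)) ≠ ⊤) ∧
    -- existence and uniqueness of the multiplier
    (∃! lam : ℝ, IsMultiplier P U a ξ v lam) ∧
    -- the candidate is the unique maximiser, and the maximum is finite
    ∀ lam : ℝ, IsMultiplier P U a ξ v lam →
      IsMaximiser (generatedFiltration P W hWm T) P ξ v U (candidate U a ξ lam) ∧
      extExpectation P (fun ω => U (candidate U a ξ lam ω)) ≠ ⊥ ∧
      ∀ X : Ω → ℝ, IsMaximiser (generatedFiltration P W hWm T) P ξ v U X →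
        X =ᵐ[P] candidate U a ξ lam := by
  have hS : IsStatePriceDensity (generatedFiltration P W hWm T) P ξ :=
    hξ ▸ isStatePriceDensity_girsanovDensity hW hγ hγexp
  refine ⟨hS.memLp, fun X hX => hU.posExpectation_ne_top hv hX, hU.existsUnique_isMultiplier hS hv,
    fun lam hlam => ⟨hU.isMaximiser_candidate hS hlam, ?_,
      fun X hX => hU.ae_eq_candidate_of_isMaximiser hS hlam hX⟩⟩
  rw [hU.extExpectation_candidate hS hlam.1]
  exact EReal.coe_ne_bot _
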